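/- Let $\mathbb{T}^2=(\mathbb{R}/2\pi\mathbb{Z})^2$, $\widehat u(k)=\int_{\mathbb{T}^2}u(x)e^{-ik\cdot x}\,dx$ and $\|u\|_{H^2}=\frac1{2\pi}\big(\sum_{k\in\mathbb{Z}^2}(1+|k|^{4})|\widehat u(k)|^2\big)^{1/2}$. For $\nu>0$ put $f(u)=u^3-u$, $F(u)=\frac14(u^2-1)^2$ and $$E(u)=\int_{\mathbb{T}^2}\Big(\frac{\nu}{2}|\nabla u|^2+F(u)\Big)\,dx .$$ For an integer $N\ge 2$ let $\Pi_N$ be the truncation to the Fourier modes $|k|_\infty\le N$ and $X_N=\mathrm{span}\{\cos(k\cdot x),\sin(k\cdot x): k\in\mathbb{Z}^2,\ |k|_\infty\le N\}$. Given a real-valued $u_0\in H^2(\mathbb{T}^2)$, a time step $\tau>0$ and $S>0$, consider the stabilized first-order exponential integrator Fourier-spectral scheme for the Cahn–Hilliard equation $\partial_t u=\Delta(-\nu\Delta u+f(u))$: $u^n\in X_N$ for all $n\ge0$, $u^0=\Pi_Nu_0$ and $$u^{n+1}=e^{-\nu\Delta^2\tau}u^n+\frac{1-e^{-\nu\Delta^2\tau}}{\nu\Delta}\Pi_N[f(u^n)]-S\tau\Delta^2(u^{n+1}-u^n),\qquad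 n\ge 0,$$ or, equivalently, $$\frac{u^{n+1}-u^n}{\tau}+S\Delta^2(u^{n+1}-u^n)=\frac{e^{-\nu\Delta^2\tau}-1}{\tau}u^n+\frac{1-e^{-\nu\Delta^2\tau}}{\tau\nu\Delta}\Pi_N[f(u^n)],\qquad n\ge 0,$$ where functions of $\Delta$ act as Fourier multipliers (with $\Delta\mapsto-|k|^2$), the symbol of $\frac{1-e^{-\nu\Delta^2\tau}}{\nu\Delta}$ at $k=0$ being its limit value $0$. Then there is a function $\beta_0:\mathbb{R}\to(0,\infty)$, independent of $\nu$, $u_0$, $N$, $S$ and $\tau$ (so that the constant $\beta_0(E(u_0))$ depends only on the initial energy $E(u_0)$), such that for all $\nu>0$, $u_0\in H^2(\mathbb{T}^2)$ and $N\ge2$: if $$S\ \ge\ \beta\Big(\|u_0\|_{H^2}^2+\nu^{-1}|\log\nu|+\nu^{-1}\log N+\nu\Big)\quad\text{for some }\beta\ge\beta_0(E(u_0)),$$ then for every time step $\tau>0$ the solution of the scheme satisfies $E(u^{n+1})\le E(u^n)$ for all $n\ge0$. -/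

import Mathlib

open MeasureTheory Real
open scoped ContDiff

noncomputable section

namespace CahnHilliard

instance instFactTwoPiPos : Fact (0 < 2 * π) := ⟨Real.two_pi_pos⟩

/-- The two-dimensional `2π`-periodic torus `(ℝ / 2πℤ)²`; its `volume` is the product of the
Lebesgue measures on the two circles of length `2π`. -/
abbrev Torus : Type := Fin 2 → AddCircle (2 * π)

/-! ### Weak derivatives and Sobolev spaces -/

/-- Smooth functions on the torus: the periodic lift to `ℝ²` is `C^∞`.  The torus is compact, so
these are the test functions. -/
def IsSmooth (φ : Torus → ℝ) : Prop :=
  ContDiff ℝ ∞ (fun y : Fin 2 → ℝ => φ (fun i => (y i : AddCircle (2 * π))))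

/-- The classical partial derivative `∂ᵢ φ` on the torus. -/
def partialDeriv (i : Fin 2) (φ : Torus → ℝ) (x : Torus) : ℝ :=
  deriv (fun t : ℝ => φ (x + Pi.single i (t : AddCircle (2 * π)))) 0

/-- `v` is the weak partial derivative `∂ᵢ u`. -/
def HasWeakDeriv (i : Fin 2) (u v : Torus → ℝ) : Prop :=
  Integrable u ∧ Integrable v ∧
    ∀ φ : Torus → ℝ, IsSmooth φ → ∫ x, u x * partialDeriv i φ x = - ∫ x, v x * φ x

/-- `u ∈ H^s(𝕋²)` for an integer `s ≥ 0`: `u` and all its weak derivatives of order at most `s`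
exist and are square integrable. -/
def MemSobolev : ℕ → (Torus → ℝ) → Prop
  | 0, u => MemLp u 2 volume
  | s + 1, u => MemLp u 2 volume ∧ ∀ i : Fin 2, ∃ v : Torus → ℝ, HasWeakDeriv i u v ∧ MemSobolev s v

open scoped Classical in
/-- A square integrable representative of the weak derivative `∂ᵢ u`, which is unique up to null
sets (and `0` if there is none). -/
def weakDeriv (i : Fin 2) (u : Torus → ℝ) : Torus → ℝ :=
  if h : ∃ v : Torus → ℝ, HasWeakDeriv i u v ∧ MemLp v 2 volume then h.choose else 0

/-! ### Fourier analysis -/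

/-- The character `x ↦ e^{i k·x}` of the torus. -/
def character (k : Fin 2 → ℤ) (x : Torus) : ℂ := ∏ i, fourier (k i) (x i)

/-- The Fourier coefficient `û(k) = ∫ u(x) e^{-i k·x} dx`. -/
def fourierCoef (u : Torus → ℝ) (k : Fin 2 → ℤ) : ℂ := ∫ x, (u x : ℂ) * character (-k) x

/-- `|k|² = k₁² + k₂²`. -/
def freqSq (k : Fin 2 → ℤ) : ℝ := ∑ i, (k i : ℝ) ^ 2

/-- The norm `‖u‖_{H^s} = (2π)⁻¹ (∑ₖ (1 + |k|^{2s}) |û(k)|²)^{1/2}`. -/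
def sobolevNorm (s : ℕ) (u : Torus → ℝ) : ℝ :=
  (2 * π)⁻¹ * √(∑' k : Fin 2 → ℤ, (1 + freqSq k ^ s) * ‖fourierCoef u k‖ ^ 2)

/-- The frequencies `k ∈ ℤ²` with `|k|_∞ ≤ N`. -/
def freqBox (N : ℕ) : Finset (Fin 2 → ℤ) :=
  Fintype.piFinset fun _ => Finset.Icc (-(N : ℤ)) (N : ℤ)

/-- The space `X_N` spanned by `cos (k·x)`, `sin (k·x)` with `|k|_∞ ≤ N`. -/
def trigSpace (N : ℕ) : Submodule ℝ (Torus → ℝ) :=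
  Submodule.span ℝ
    {g | ∃ k ∈ freqBox N, g = (fun x => (character k x).re) ∨ g = (fun x => (character k x).im)}

/-- The operator `g(Δ) Π_N`: it keeps the Fourier modes `|k|_∞ ≤ N` and multiplies the mode `k` by
`g (-|k|²)`, the number `-|k|²` being the symbol of `Δ`.  On `X_N` it is the Fourier multiplier
`g(Δ)`. The real part only turns a complex expression with zero imaginary part into a real one,
because `û(-k)` is the conjugate of `û(k)` and `|k|² = |-k|²`. -/
def laplaceFun (N : ℕ) (g : ℝ → ℝ) (u : Torus → ℝ) : Torus → ℝ := fun x =>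
  ((2 * π) ^ 2)⁻¹ * ∑ k ∈ freqBox N, g (-freqSq k) * (fourierCoef u k * character k x).re

/-- The truncation `Π_N` to the Fourier modes `|k|_∞ ≤ N`. -/
def fourierProj (N : ℕ) (u : Torus → ℝ) : Torus → ℝ := laplaceFun N (fun _ => 1) u

/-! ### The energy and the scheme -/

/-- The double-well potential `F(u) = (u² - 1)² / 4`. -/
def doubleWell (r : ℝ) : ℝ := (r ^ 2 - 1) ^ 2 / 4

/-- The derivative `f(u) = F'(u) = u³ - u` of the double-well potential. -/
def doubleWellDeriv (r : ℝ) : ℝ := r ^ 3 - r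

/-- The energy `E(u) = ∫ (ν/2 |∇u|² + F(u)) dx`. -/
def energy (ν : ℝ) (u : Torus → ℝ) : ℝ :=
  ∫ x, (ν / 2 * ∑ i, weakDeriv i u x ^ 2 + doubleWell (u x))

/-- The function `L ↦ e^{-ν L² τ}`, so that `expSymbol ν τ` evaluated at `Δ` is `e^{-ν Δ² τ}`. -/
def expSymbol (ν τ : ℝ) (L : ℝ) : ℝ := Real.exp (-ν * L ^ 2 * τ)

/-- The function `L ↦ (1 - e^{-ν L² τ}) / (ν L)`; the value at `L = 0` (zero frequency) is its
limit `0`. -/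
def phiSymbol (ν τ : ℝ) (L : ℝ) : ℝ := (1 - Real.exp (-ν * L ^ 2 * τ)) / (ν * L)

/-- The stabilized exponential integrator scheme: all `uⁿ` lie in `X_N`, `u⁰ = Π_N u₀`, and
`uⁿ⁺¹ = e^{-νΔ²τ} uⁿ + (1 - e^{-νΔ²τ}) / (νΔ) Π_N f(uⁿ) - S τ Δ² (uⁿ⁺¹ - uⁿ)`. -/
def IsEIScheme (ν S τ : ℝ) (N : ℕ) (u₀ : Torus → ℝ) (u : ℕ → Torus → ℝ) : Prop :=
  (∀ n, u n ∈ trigSpace N) ∧ u 0 = fourierProj N u₀ ∧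
    ∀ n, u (n + 1) =
      laplaceFun N (expSymbol ν τ) (u n)
        + laplaceFun N (phiSymbol ν τ) (fourierProj N (fun x => doubleWellDeriv (u n x)))
        - (S * τ) • laplaceFun N (fun L => L ^ 2) (u (n + 1) - u n)

/-- The same scheme written as a difference quotient: all `uⁿ` lie in `X_N`, `u⁰ = Π_N u₀`, and
`(uⁿ⁺¹ - uⁿ) / τ + S Δ² (uⁿ⁺¹ - uⁿ)
  = (e^{-νΔ²τ} - 1) / τ uⁿ + (1 - e^{-νΔ²τ}) / (τνΔ) Π_N f(uⁿ)`. -/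
def IsEISchemeQuot (ν S τ : ℝ) (N : ℕ) (u₀ : Torus → ℝ) (u : ℕ → Torus → ℝ) : Prop :=
  (∀ n, u n ∈ trigSpace N) ∧ u 0 = fourierProj N u₀ ∧
    ∀ n, τ⁻¹ • (u (n + 1) - u n) + S • laplaceFun N (fun L => L ^ 2) (u (n + 1) - u n) =
      laplaceFun N (fun L => (expSymbol ν τ L - 1) / τ) (u n)
        + laplaceFun N (fun L => phiSymbol ν τ L / τ)
            (fourierProj N (fun x => doubleWellDeriv (u n x)))

end CahnHilliard

end

noncomputable section

namespace CahnHilliard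

open scoped ComplexConjugate

/-! ### Characters -/

/-! In Fourier variables, with q = |k|² and a = 1 - exp(-νq²τ), a step u ↦ w reads νq(1 + Sτq²)(ŵ -
û) = -a(νqû + f̂), where f = u³ - u, and it preserves the mean. Since a ≤ min(1, νq²τ), the
left-hand factor is at least (ν + S)q·a. Pairing the equation with ŵ - û therefore produces the
dissipation (ν + S)q|ŵ - û|², with no τ left (`energy_mode_le`). The double well exceeds its
linearization by at most 5B²(w - u)² when |u| ≤ B and |w| ≤ 3B (`doubleWell_sub_le`). As w - u has
mean zero and q ≥ 1 on the other modes, S ≥ 5B² makes the energy decrease (`IsStep.energy_le`).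

It remains to bound both sup norms by the energy. On X_N the sum of |k|⁻² over nonzero modes is
O(log N), so Cauchy–Schwarz gives |u| ≤ B = 2 + E + √(2E log N / ν) (`sum_norm_fourierCoef_le`). The
step equation gives |ŵ| ≤ 2|û| + |f̂|/(Sq), and the same summation yields |w| ≤ 3B
(`IsStep.sup_bound`). Hence S of order log N / ν + ν suffices, with a factor depending on an energy
bound.

That bound must come from E(u₀), whereas the scheme starts at Π_N u₀. Truncation does not increase
the gradient part, and it is bounded on L⁴ uniformly in N (`integral_norm_trigSum_freqBox_le`), so
E(Π_N u₀) is bounded by an affine function of E(u₀) (`energy_fourierProj_le`). Induction on n then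
propagates this bound along the scheme. -/

lemma continuous_character (k : Fin 2 → ℤ) : Continuous (character k) := by
  unfold character
  fun_prop

lemma character_zero (x : Torus) : character 0 x = 1 := by
  simp [character]

lemma character_add (k l : Fin 2 → ℤ) (x : Torus) :
    character (k + l) x = character k x * character l x := by
  simp only [character, Pi.add_apply, fourier_add, ← Finset.prod_mul_distrib]

lemma character_neg (k : Fin 2 → ℤ) (x : Torus) :
    character (-k) x = conj (character k x) := by
  simp only [character, Pi.neg_apply, fourier_neg, map_prod]

lemma norm_character (k : Fin 2 → ℤ) (x : Torus) : ‖character k x‖ = 1 := by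
  simp only [character, norm_prod, fourier_apply, Circle.norm_coe, Finset.prod_const_one]

lemma integrable_of_continuous {E : Type*} [NormedAddCommGroup E] {f : Torus → E}
    (hf : Continuous f) : Integrable f := by
  have h := hf.continuousOn.integrableOn_compact (μ := volume) (isCompact_univ)
  rwa [integrableOn_univ] at h

lemma integral_fourier (n : ℤ) :
    ∫ x : AddCircle (2 * π), fourier n x = if n = 0 then ((2 * π : ℝ) : ℂ) else 0 := by
  split_ifs with h
  · subst h
    simp only [fourier_zero, integral_const, Measure.real, AddCircle.measure_univ]
    rw [ENNReal.toReal_ofReal Real.two_pi_pos.le]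
    simp
  · exact integral_eq_zero_of_add_right_eq_neg (μ := (volume : Measure (AddCircle (2 * π))))
      (fourier_add_half_inv_index h Real.two_pi_pos)

lemma integral_character (k : Fin 2 → ℤ) :
    ∫ x, character k x = if k = 0 then (((2 * π) ^ 2 : ℝ) : ℂ) else 0 := by
  unfold character
  rw [integral_fintype_prod_volume_eq_prod (𝕜 := ℂ)
    (fun i (x : AddCircle (2 * π)) => fourier (k i) x)]
  simp only [integral_fourier, Fin.prod_univ_two]
  by_cases h0 : k 0 = 0 <;> by_cases h1 : k 1 = 0
  · have : k = 0 := by ext i; fin_cases i <;> simp [h0, h1]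
    simp [this, sq]
  all_goals
    have : k ≠ 0 := fun h => by simp [h] at h0 h1
    simp [this, h0, h1]

/-! ### Fourier coefficients -/

lemma fourierCoef_neg (u : Torus → ℝ) (k : Fin 2 → ℤ) :
    fourierCoef u (-k) = conj (fourierCoef u k) := by
  unfold fourierCoef
  rw [← integral_conj]
  congr 1; ext x
  simp [character_neg]

lemma integrable_mul_character {u : Torus → ℝ} (hu : Integrable u) (k : Fin 2 → ℤ) :
    Integrable fun x => (u x : ℂ) * character k x :=
  hu.ofReal.mul_bdd (c := 1) (continuous_character k).aestronglyMeasurable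
    (Filter.Eventually.of_forall fun x => (norm_character k x).le)

lemma fourierCoef_sub {u v : Torus → ℝ} (hu : Integrable u) (hv : Integrable v)
    (k : Fin 2 → ℤ) : fourierCoef (u - v) k = fourierCoef u k - fourierCoef v k := by
  unfold fourierCoef
  rw [← integral_sub (integrable_mul_character hu _) (integrable_mul_character hv _)]
  congr 1; ext x
  simp [sub_mul]

lemma fourierCoef_add {u v : Torus → ℝ} (hu : Integrable u) (hv : Integrable v)
    (k : Fin 2 → ℤ) : fourierCoef (u + v) k = fourierCoef u k + fourierCoef v k := by
  unfold fourierCoef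
  rw [← integral_add (integrable_mul_character hu _) (integrable_mul_character hv _)]
  congr 1; ext x
  simp [add_mul]

lemma fourierCoef_smul (c : ℝ) (u : Torus → ℝ) (k : Fin 2 → ℤ) :
    fourierCoef (c • u) k = c * fourierCoef u k := by
  unfold fourierCoef
  rw [← integral_const_mul]
  congr 1; ext x
  simp [mul_assoc]

/-! ### Trigonometric polynomials -/

lemma mem_freqBox {N : ℕ} {k : Fin 2 → ℤ} : k ∈ freqBox N ↔ ∀ i, |k i| ≤ N := by
  simp [freqBox, abs_le]

lemma neg_mem_freqBox {N : ℕ} {k : Fin 2 → ℤ} : -k ∈ freqBox N ↔ k ∈ freqBox N := by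
  simp [mem_freqBox]

lemma freqSq_neg (k : Fin 2 → ℤ) : freqSq (-k) = freqSq k := by
  simp [freqSq]

lemma freqSq_nonneg (k : Fin 2 → ℤ) : 0 ≤ freqSq k :=
  Finset.sum_nonneg fun _ _ => sq_nonneg _

lemma freqSq_zero : freqSq 0 = 0 := by simp [freqSq]

lemma one_le_freqSq {k : Fin 2 → ℤ} (hk : k ≠ 0) : 1 ≤ freqSq k := by
  have h : freqSq k = ((k 0 ^ 2 + k 1 ^ 2 : ℤ) : ℝ) := by simp [freqSq]
  rw [h]
  have : 0 < k 0 ^ 2 + k 1 ^ 2 := by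
    by_contra hcon
    apply hk
    have h0 : k 0 ^ 2 = 0 := by nlinarith [sq_nonneg (k 0), sq_nonneg (k 1)]
    have h1 : k 1 ^ 2 = 0 := by nlinarith [sq_nonneg (k 0), sq_nonneg (k 1)]
    ext i; fin_cases i
    · simpa using h0
    · simpa using h1
  exact_mod_cast this

lemma sum_freqBox_neg {M : Type*} [AddCommMonoid M] (N : ℕ) (f : (Fin 2 → ℤ) → M) :
    ∑ k ∈ freqBox N, f (-k) = ∑ k ∈ freqBox N, f k :=
  Finset.sum_nbij' (fun k => -k) (fun k => -k) (fun _ h => neg_mem_freqBox.2 h)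
    (fun _ h => neg_mem_freqBox.2 h) (by simp) (by simp) (by simp)

/-- A finite combination of characters. -/
def trigSum (s : Finset (Fin 2 → ℤ)) (c : (Fin 2 → ℤ) → ℂ) (x : Torus) : ℂ :=
  ∑ k ∈ s, c k * character k x

lemma continuous_trigSum (s : Finset (Fin 2 → ℤ)) (c : (Fin 2 → ℤ) → ℂ) :
    Continuous (trigSum s c) := by
  unfold trigSum
  exact continuous_finsetSum _ fun k _ => continuous_const.mul (continuous_character k)

lemma integral_mul_trigSum {v : Torus → ℝ} (hv : Integrable v) (s : Finset (Fin 2 → ℤ))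
    (c : (Fin 2 → ℤ) → ℂ) :
    ∫ x, (v x : ℂ) * trigSum s c x = ∑ k ∈ s, c k * conj (fourierCoef v k) := by
  have h : ∀ x, (v x : ℂ) * trigSum s c x = ∑ k ∈ s, c k * ((v x : ℂ) * character k x) := by
    intro x
    rw [trigSum, Finset.mul_sum]
    exact Finset.sum_congr rfl fun k _ => by ring
  simp_rw [h]
  rw [integral_finsetSum _ fun k _ => (integrable_mul_character hv k).const_mul _]
  refine Finset.sum_congr rfl fun k _ => ?_
  rw [integral_const_mul, ← fourierCoef_neg, fourierCoef, neg_neg]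

lemma integral_trigSum_mul_character (s : Finset (Fin 2 → ℤ)) (c : (Fin 2 → ℤ) → ℂ)
    (l : Fin 2 → ℤ) :
    ∫ x, trigSum s c x * character (-l) x = if l ∈ s then ((2 * π) ^ 2 : ℝ) * c l else 0 := by
  have h : ∀ x, trigSum s c x * character (-l) x = ∑ k ∈ s, c k * character (k - l) x := by
    intro x
    rw [trigSum, Finset.sum_mul]
    exact Finset.sum_congr rfl fun k _ => by rw [sub_eq_add_neg, character_add]; ring
  simp_rw [h]
  rw [integral_finsetSum _ fun k _ =>
    (integrable_of_continuous (continuous_character (k - l))).const_mul (c k)]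
  simp_rw [integral_const_mul, integral_character, sub_eq_zero, mul_ite, mul_zero]
  rw [Finset.sum_ite_eq' s l]
  split_ifs <;> ring

lemma fourierCoef_of_eq_trigSum {u : Torus → ℝ} {s : Finset (Fin 2 → ℤ)}
    {c : (Fin 2 → ℤ) → ℂ} (h : ∀ x, (u x : ℂ) = trigSum s c x) (l : Fin 2 → ℤ) :
    fourierCoef u l = if l ∈ s then ((2 * π) ^ 2 : ℝ) * c l else 0 := by
  rw [fourierCoef, ← integral_trigSum_mul_character]
  simp_rw [h]

/-- The multiplier is real and even in k and u is real, so exchanging k and -k shows that the full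
complex sum is its own conjugate. The real part in the definition thus loses nothing. -/
lemma ofReal_laplaceFun (N : ℕ) (g : ℝ → ℝ) (u : Torus → ℝ) (x : Torus) :
    (laplaceFun N g u x : ℂ) = trigSum (freqBox N)
      (fun k => (((2 * π) ^ 2)⁻¹ : ℝ) * (g (-freqSq k) * fourierCoef u k)) x := by
  have h1 : trigSum (freqBox N)
      (fun k => (((2 * π) ^ 2)⁻¹ : ℝ) * (g (-freqSq k) * fourierCoef u k)) x
      = (((2 * π) ^ 2)⁻¹ : ℝ) *
        ∑ k ∈ freqBox N, (g (-freqSq k) : ℂ) * (fourierCoef u k * character k x) := by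
    rw [trigSum, Finset.mul_sum]
    exact Finset.sum_congr rfl fun k _ => by ring
  set T := ∑ k ∈ freqBox N, (g (-freqSq k) : ℂ) * (fourierCoef u k * character k x) with hT
  have h2 : conj T = T := by
    rw [hT, map_sum, ← sum_freqBox_neg]
    refine Finset.sum_congr rfl fun k _ => ?_
    rw [freqSq_neg, fourierCoef_neg, character_neg]
    simp
  have h3 : ((T.re : ℝ) : ℂ) = T := Complex.conj_eq_iff_re.1 h2
  rw [h1, ← h3, laplaceFun, ← Complex.ofReal_mul, hT, Complex.re_sum]
  simp only [Complex.re_ofReal_mul]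

lemma two_pi_sq_ne_zero : ((2 * π) ^ 2 : ℝ) ≠ 0 := by positivity

lemma fourierCoef_laplaceFun (N : ℕ) (g : ℝ → ℝ) (u : Torus → ℝ) (k : Fin 2 → ℤ) :
    fourierCoef (laplaceFun N g u) k
      = if k ∈ freqBox N then g (-freqSq k) * fourierCoef u k else 0 := by
  rw [fourierCoef_of_eq_trigSum (ofReal_laplaceFun N g u)]
  split_ifs
  · rw [← mul_assoc, ← Complex.ofReal_mul, mul_inv_cancel₀ two_pi_sq_ne_zero]
    simp
  · rfl

lemma fourierCoef_fourierProj (N : ℕ) (u : Torus → ℝ) (k : Fin 2 → ℤ) :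
    fourierCoef (fourierProj N u) k = if k ∈ freqBox N then fourierCoef u k else 0 := by
  rw [fourierProj, fourierCoef_laplaceFun]
  simp

lemma continuous_laplaceFun (N : ℕ) (g : ℝ → ℝ) (u : Torus → ℝ) :
    Continuous (laplaceFun N g u) := by
  unfold laplaceFun
  have := fun k => continuous_character k
  fun_prop

lemma ofReal_fourierProj (N : ℕ) (u : Torus → ℝ) (x : Torus) :
    (fourierProj N u x : ℂ) =
      trigSum (freqBox N) (fun k => (((2 * π) ^ 2)⁻¹ : ℝ) * fourierCoef u k) x := by
  rw [fourierProj, ofReal_laplaceFun]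
  simp

lemma exists_trigSum_of_mem_trigSpace {N : ℕ} {u : Torus → ℝ} (hu : u ∈ trigSpace N) :
    ∃ c, ∀ x, (u x : ℂ) = trigSum (freqBox N) c x := by
  unfold trigSpace at hu
  induction hu using Submodule.span_induction with
  | mem g hg =>
    obtain ⟨k, hk, hg⟩ := hg
    have hk' : -k ∈ freqBox N := neg_mem_freqBox.2 hk
    -- The two indicators are added rather than chosen between, so k = 0, where k = -k, needs no
    -- separate case.
    have key : ∀ (a b : ℂ) (x : Torus), trigSum (freqBox N)
        (fun l => (if l = k then a else 0) + (if l = -k then b else 0)) x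
        = a * character k x + b * conj (character k x) := by
      intro a b x
      rw [← character_neg]
      simp only [trigSum, add_mul, Finset.sum_add_distrib, ite_mul, zero_mul, Finset.sum_ite_eq',
        hk, hk', if_true]
    rcases hg with rfl | rfl
    · refine ⟨_, fun x => Eq.trans ?_ (key (1 / 2) (1 / 2) x).symm⟩
      rw [Complex.re_eq_add_conj]; ring
    · refine ⟨_, fun x => Eq.trans ?_
        (key (1 / (2 * Complex.I)) (-(1 / (2 * Complex.I))) x).symm⟩
      rw [Complex.im_eq_sub_conj]; ring
  | zero => exact ⟨0, fun x => by simp [trigSum]⟩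
  | add f g _ _ hf hg =>
    obtain ⟨a, ha⟩ := hf
    obtain ⟨b, hb⟩ := hg
    refine ⟨a + b, fun x => ?_⟩
    simp [ha, hb, trigSum, add_mul, Finset.sum_add_distrib]
  | smul r f _ hf =>
    obtain ⟨a, ha⟩ := hf
    refine ⟨fun k => r * a k, fun x => ?_⟩
    simp [ha, trigSum, Finset.mul_sum, mul_assoc]

/-- Fourier inversion on `X_N`. -/
lemma fourierProj_eq_self {N : ℕ} {u : Torus → ℝ} (hu : u ∈ trigSpace N) :
    fourierProj N u = u := by
  obtain ⟨c, hc⟩ := exists_trigSum_of_mem_trigSpace hu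
  ext x
  have : (fourierProj N u x : ℂ) = u x := by
    rw [ofReal_fourierProj, hc x, trigSum, trigSum]
    refine Finset.sum_congr rfl fun k hk => ?_
    rw [fourierCoef_of_eq_trigSum hc, if_pos hk, ← mul_assoc, ← Complex.ofReal_mul,
      inv_mul_cancel₀ two_pi_sq_ne_zero]
    simp
  exact_mod_cast this

lemma continuous_of_mem_trigSpace {N : ℕ} {u : Torus → ℝ} (hu : u ∈ trigSpace N) :
    Continuous u := by
  rw [← fourierProj_eq_self hu]
  exact continuous_laplaceFun _ _ _

lemma fourierCoef_eq_zero_of_mem_trigSpace {N : ℕ} {u : Torus → ℝ} (hu : u ∈ trigSpace N)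
    {k : Fin 2 → ℤ} (hk : k ∉ freqBox N) : fourierCoef u k = 0 := by
  rw [← fourierProj_eq_self hu, fourierCoef_fourierProj, if_neg hk]

lemma laplaceFun_mem_trigSpace (N : ℕ) (g : ℝ → ℝ) (u : Torus → ℝ) :
    laplaceFun N g u ∈ trigSpace N := by
  have h : laplaceFun N g u = ∑ k ∈ freqBox N,
      ((((2 * π) ^ 2)⁻¹ * g (-freqSq k) * (fourierCoef u k).re) • (fun x => (character k x).re)
      - (((2 * π) ^ 2)⁻¹ * g (-freqSq k) * (fourierCoef u k).im) •
        (fun x => (character k x).im)) := by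
    ext x
    simp only [laplaceFun, Finset.mul_sum, Finset.sum_apply, Pi.sub_apply, Pi.smul_apply,
      smul_eq_mul, Complex.mul_re]
    exact Finset.sum_congr rfl fun k _ => by ring
  rw [h]
  refine Submodule.sum_mem _ fun k hk => Submodule.sub_mem _ (Submodule.smul_mem _ _ ?_)
    (Submodule.smul_mem _ _ ?_)
  · exact Submodule.subset_span ⟨k, hk, Or.inl rfl⟩
  · exact Submodule.subset_span ⟨k, hk, Or.inr rfl⟩

lemma fourierProj_mem_trigSpace (N : ℕ) (u : Torus → ℝ) : fourierProj N u ∈ trigSpace N :=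
  laplaceFun_mem_trigSpace _ _ _

/-- Parseval's identity for the pairing with an element of `X_N`. -/
lemma integral_mul_of_mem_trigSpace {N : ℕ} {u v : Torus → ℝ} (hu : u ∈ trigSpace N)
    (hv : Integrable v) :
    ∫ x, v x * u x = ((2 * π) ^ 2)⁻¹ *
      ∑ k ∈ freqBox N, (fourierCoef u k * conj (fourierCoef v k)).re := by
  have h : ∀ x, (v x : ℂ) * trigSum (freqBox N)
      (fun k => (((2 * π) ^ 2)⁻¹ : ℝ) * fourierCoef u k) x = ((v x * u x : ℝ) : ℂ) := by
    intro x
    rw [← ofReal_fourierProj, fourierProj_eq_self hu]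
    simp
  have h2 := integral_mul_trigSum hv (freqBox N)
    (fun k => (((2 * π) ^ 2)⁻¹ : ℝ) * fourierCoef u k)
  simp_rw [h, integral_complex_ofReal, mul_assoc] at h2
  rw [← Finset.mul_sum] at h2
  have h3 := congrArg Complex.re h2
  rwa [Complex.ofReal_re, Complex.re_ofReal_mul, Complex.re_sum] at h3

lemma integral_sq_of_mem_trigSpace {N : ℕ} {u : Torus → ℝ} (hu : u ∈ trigSpace N) :
    ∫ x, u x ^ 2 = ((2 * π) ^ 2)⁻¹ * ∑ k ∈ freqBox N, ‖fourierCoef u k‖ ^ 2 := by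
  simp_rw [sq (u _)]
  rw [integral_mul_of_mem_trigSpace hu
    (integrable_of_continuous (continuous_of_mem_trigSpace hu))]
  congr 1
  refine Finset.sum_congr rfl fun k _ => ?_
  rw [Complex.mul_conj, Complex.ofReal_re, Complex.normSq_eq_norm_sq]

/-- Bessel's inequality on the frequency box. -/
lemma sum_sq_fourierCoef_le {v : Torus → ℝ} (hv : MemLp v 2) (N : ℕ) :
    ∑ k ∈ freqBox N, ‖fourierCoef v k‖ ^ 2 ≤ (2 * π) ^ 2 * ∫ x, v x ^ 2 := by
  have hp := fourierProj_mem_trigSpace N v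
  set p := fourierProj N v with hpdef
  have hcoef : ∀ k ∈ freqBox N, fourierCoef p k = fourierCoef v k := fun k hk => by
    rw [hpdef, fourierCoef_fourierProj, if_pos hk]
  have hpc := continuous_of_mem_trigSpace hp
  have hvi : Integrable v := hv.integrable one_le_two
  have h1 : ∫ x, v x * p x = ((2 * π) ^ 2)⁻¹ * ∑ k ∈ freqBox N, ‖fourierCoef v k‖ ^ 2 := by
    rw [integral_mul_of_mem_trigSpace hp hvi]
    congr 1
    refine Finset.sum_congr rfl fun k hk => ?_
    rw [hcoef k hk, Complex.mul_conj, Complex.ofReal_re, Complex.normSq_eq_norm_sq]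
  have h2 : ∫ x, p x ^ 2 = ((2 * π) ^ 2)⁻¹ * ∑ k ∈ freqBox N, ‖fourierCoef v k‖ ^ 2 := by
    rw [integral_sq_of_mem_trigSpace hp]
    congr 1
    exact Finset.sum_congr rfl fun k hk => by rw [hcoef k hk]
  have hv2 : Integrable fun x => v x ^ 2 := hv.integrable_sq
  have hp2 : Integrable fun x => p x ^ 2 := integrable_of_continuous (hpc.pow 2)
  have hvp : Integrable fun x => v x * p x := by
    have : MemLp p 2 := by
      rw [memLp_two_iff_integrable_sq hpc.aestronglyMeasurable]; exact hp2
    exact hv.integrable_mul this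
  have h3 : 0 ≤ ∫ x, (v x - p x) ^ 2 := integral_nonneg fun x => sq_nonneg _
  have h4 : ∫ x, (v x - p x) ^ 2 = (∫ x, v x ^ 2) - 2 * (∫ x, v x * p x) + ∫ x, p x ^ 2 := by
    rw [← integral_const_mul, ← integral_sub hv2 (hvp.const_mul 2),
      ← integral_add (f := fun x => v x ^ 2 - 2 * (v x * p x)) (hv2.sub (hvp.const_mul 2)) hp2]
    congr 1; ext x; ring
  rw [h4, h1, h2] at h3
  have h5 : ((2 * π) ^ 2)⁻¹ * ∑ k ∈ freqBox N, ‖fourierCoef v k‖ ^ 2 ≤ ∫ x, v x ^ 2 := by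
    linarith
  rwa [inv_mul_le_iff₀ (by positivity)] at h5

/-! ### Completeness of the characters -/

/-- A character as a continuous map. -/
def characterMap (k : Fin 2 → ℤ) : C(Torus, ℂ) := ⟨character k, continuous_character k⟩

/-- The star algebra generated by the characters. -/
def characterSubalgebra : StarSubalgebra ℂ C(Torus, ℂ) where
  toSubalgebra := Algebra.adjoin ℂ (Set.range characterMap)
  star_mem' := by
    change Algebra.adjoin ℂ (Set.range characterMap) ≤
      star (Algebra.adjoin ℂ (Set.range characterMap))
    refine Algebra.adjoin_le ?_
    rintro _ ⟨n, rfl⟩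
    refine Algebra.subset_adjoin ⟨-n, ?_⟩
    ext1 x
    exact character_neg n x

lemma characterSubalgebra_coe :
    characterSubalgebra.toSubalgebra.toSubmodule =
      Submodule.span ℂ (Set.range characterMap) := by
  apply Algebra.adjoin_eq_span_of_subset
  refine .trans (fun x ↦ Submonoid.closure_induction (fun _ ↦ id) ⟨0, ?_⟩ ?_)
    Submodule.subset_span
  · ext z
    exact character_zero z
  · rintro _ _ _ _ ⟨m, rfl⟩ ⟨n, rfl⟩
    refine ⟨m + n, ?_⟩
    ext z
    exact character_add m n z

lemma character_single (i : Fin 2) (x : Torus) :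
    character (Pi.single i 1) x = AddCircle.toCircle (x i) := by
  fin_cases i <;> simp [character]

lemma characterSubalgebra_separatesPoints : characterSubalgebra.SeparatesPoints := by
  intro x y hxy
  rw [Ne, funext_iff, not_forall] at hxy
  obtain ⟨i, hi⟩ := hxy
  refine ⟨_, ⟨characterMap (Pi.single i 1), Algebra.subset_adjoin ⟨Pi.single i 1, rfl⟩, rfl⟩, ?_⟩
  change character _ x ≠ character _ y
  rw [character_single, character_single]
  exact fun h => hi (AddCircle.injective_toCircle Real.two_pi_pos.ne' (Circle.ext h))

lemma span_characterMap_closure_eq_top :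
    (Submodule.span ℂ (Set.range characterMap)).topologicalClosure = ⊤ := by
  rw [← characterSubalgebra_coe]
  exact congr_arg (Subalgebra.toSubmodule <| StarSubalgebra.toSubalgebra ·)
    (ContinuousMap.starSubalgebra_topologicalClosure_eq_top_of_separatesPoints _
      characterSubalgebra_separatesPoints)

/-- By Stone–Weierstrass the characters span a dense subspace of the continuous functions, which are
dense in L². A function with vanishing coefficients is orthogonal to a dense subspace. -/
lemma ae_eq_zero_of_fourierCoef {v : Torus → ℝ} (hv : MemLp v 2)
    (h : ∀ k, fourierCoef v k = 0) : v =ᵐ[volume] 0 := by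
  have hvc : MemLp (fun x => (v x : ℂ)) 2 := hv.ofReal
  have hdense : (Submodule.span ℂ (Set.range fun k => ContinuousMap.toLp (E := ℂ) 2
      (volume : Measure Torus) ℂ (characterMap k))).topologicalClosure = ⊤ := by
    have := (ContinuousMap.toLp_denseRange ℂ (volume : Measure Torus) ℂ
      (p := 2) (by simp)).topologicalClosure_map_submodule span_characterMap_closure_eq_top
    rw [Submodule.map_span, ← Set.range_comp] at this
    exact this
  have hz : hvc.toLp = 0 := by
    rw [← Submodule.mem_bot ℂ, ← Submodule.top_orthogonal_eq_bot, ← hdense,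
      Submodule.orthogonal_closure, Submodule.mem_orthogonal]
    intro w hw
    induction hw using Submodule.span_induction with
    | mem w hw =>
      obtain ⟨k, rfl⟩ := hw
      rw [L2.inner_def, ← h k, fourierCoef]
      refine integral_congr_ae ?_
      filter_upwards [ContinuousMap.coeFn_toLp (p := 2) (𝕜 := ℂ) (volume : Measure Torus)
        (characterMap k), hvc.coeFn_toLp] with x hx hx2
      rw [hx, hx2, RCLike.inner_apply, character_neg]
      rfl
    | zero => simp
    | add a b _ _ ha hb => rw [inner_add_left, ha, hb, add_zero]
    | smul c a _ ha => rw [inner_smul_left, ha, mul_zero]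
  have h2 := hvc.coeFn_toLp
  rw [hz] at h2
  filter_upwards [h2, Lp.coeFn_zero ℂ 2 (volume : Measure Torus)] with x hx hx0
  rw [hx0] at hx
  simpa using hx.symm

lemma ae_eq_of_fourierCoef_eq {u v : Torus → ℝ} (hu : MemLp u 2) (hv : MemLp v 2)
    (h : ∀ k, fourierCoef u k = fourierCoef v k) : u =ᵐ[volume] v := by
  have := ae_eq_zero_of_fourierCoef (hu.sub hv) fun k => by
    rw [fourierCoef_sub (hu.integrable one_le_two) (hv.integrable one_le_two), h, sub_self]
  filter_upwards [this] with x hx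
  exact sub_eq_zero.1 hx

/-! ### Smooth functions on the torus -/

/-- The covering map `ℝ² → 𝕋²`. -/
def torusMk (y : Fin 2 → ℝ) : Torus := fun i => (y i : AddCircle (2 * π))

lemma isOpenQuotientMap_torusMk : IsOpenQuotientMap torusMk :=
  IsOpenQuotientMap.piMap (f := fun (_ : Fin 2) (y : ℝ) => (y : AddCircle (2 * π)))
    fun _ => QuotientAddGroup.isOpenQuotientMap_mk

lemma torusMk_add_single (y : Fin 2 → ℝ) (i : Fin 2) (t : ℝ) :
    torusMk y + Pi.single i (t : AddCircle (2 * π)) = torusMk (y + t • Pi.single i 1) := by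
  ext j
  by_cases h : j = i
  · subst h; simp [torusMk]
  · simp [torusMk, Pi.single_eq_of_ne h]

lemma hasDerivAt_torusMk {φ : Torus → ℝ} (hφ : IsSmooth φ) (y : Fin 2 → ℝ) (i : Fin 2) (t : ℝ) :
    HasDerivAt (fun s : ℝ => φ (torusMk y + Pi.single i (s : AddCircle (2 * π))))
      (fderiv ℝ (fun z => φ (torusMk z)) (y + t • Pi.single i 1) (Pi.single i 1)) t := by
  simp_rw [torusMk_add_single]
  have h1 : HasDerivAt (fun s : ℝ => y + s • (Pi.single i 1 : Fin 2 → ℝ)) (Pi.single i 1) t := by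
    simpa using ((hasDerivAt_id t).smul_const (Pi.single i 1 : Fin 2 → ℝ)).const_add y
  have h2 : HasFDerivAt (fun z => φ (torusMk z)) _ (y + t • Pi.single i 1) :=
    ((ContDiff.differentiable hφ (by simp)) _).hasFDerivAt
  exact h2.comp_hasDerivAt t h1

lemma partialDeriv_torusMk {φ : Torus → ℝ} (hφ : IsSmooth φ) (y : Fin 2 → ℝ) (i : Fin 2) :
    partialDeriv i φ (torusMk y) =
      fderiv ℝ (fun z => φ (torusMk z)) y (Pi.single i 1) := by
  have := (hasDerivAt_torusMk hφ y i 0).deriv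
  rwa [zero_smul, add_zero] at this

lemma IsSmooth.continuous {φ : Torus → ℝ} (hφ : IsSmooth φ) : Continuous φ :=
  isOpenQuotientMap_torusMk.isQuotientMap.continuous_iff.2 (ContDiff.continuous hφ)

lemma IsSmooth.continuous_partialDeriv {φ : Torus → ℝ} (hφ : IsSmooth φ) (i : Fin 2) :
    Continuous (partialDeriv i φ) := by
  refine isOpenQuotientMap_torusMk.isQuotientMap.continuous_iff.2 ?_
  have : partialDeriv i φ ∘ torusMk =
      fun y => fderiv ℝ (fun z => φ (torusMk z)) y (Pi.single i 1) := by
    ext y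
    exact partialDeriv_torusMk hφ y i
  rw [this]
  exact (ContDiff.continuous_fderiv hφ (by simp)).clm_apply continuous_const

lemma IsSmooth.hasDerivAt {φ : Torus → ℝ} (hφ : IsSmooth φ) (x : Torus) (i : Fin 2) (t : ℝ) :
    HasDerivAt (fun s : ℝ => φ (x + Pi.single i (s : AddCircle (2 * π))))
      (partialDeriv i φ (x + Pi.single i (t : AddCircle (2 * π)))) t := by
  obtain ⟨y, rfl⟩ := isOpenQuotientMap_torusMk.surjective x
  rw [torusMk_add_single, partialDeriv_torusMk hφ]
  exact hasDerivAt_torusMk hφ y i t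

/-! ### Characters as test functions -/

lemma character_torusMk (k : Fin 2 → ℤ) (y : Fin 2 → ℝ) :
    character k (torusMk y) = Complex.exp ((k 0 * y 0 + k 1 * y 1) * Complex.I) := by
  have h : ∀ n : ℤ, ∀ t : ℝ, fourier n (t : AddCircle (2 * π)) = Complex.exp (n * t * Complex.I) := by
    intro n t
    rw [fourier_coe_apply]
    congr 1
    have : (π : ℂ) ≠ 0 := by exact_mod_cast Real.pi_ne_zero
    push_cast
    field_simp
  rw [character, Fin.prod_univ_two]
  simp only [torusMk, h]
  rw [← Complex.exp_add]
  congr 1; ring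

lemma character_add_arg (k : Fin 2 → ℤ) (x y : Torus) :
    character k (x + y) = character k x * character k y := by
  simp only [character, fourier_apply, Pi.add_apply, zsmul_add, AddCircle.toCircle_add,
    Circle.coe_mul, Finset.prod_mul_distrib]

lemma character_single_coe (k : Fin 2 → ℤ) (i : Fin 2) (t : ℝ) :
    character k (Pi.single i (t : AddCircle (2 * π))) = Complex.exp (t * (Complex.I * k i)) := by
  have : (Pi.single i (t : AddCircle (2 * π)) : Torus) = torusMk (t • Pi.single i 1) := by
    have := torusMk_add_single 0 i t
    have h0 : torusMk 0 = 0 := by ext j; simp [torusMk]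
    rwa [h0, zero_add, zero_add] at this
  rw [this, character_torusMk]
  congr 1
  fin_cases i <;> simp <;> ring

lemma contDiff_character (k : Fin 2 → ℤ) :
    ContDiff ℝ ∞ fun y : Fin 2 → ℝ => character k (torusMk y) := by
  simp_rw [character_torusMk]
  have h : ∀ i : Fin 2, ContDiff ℝ ∞ fun y : Fin 2 → ℝ => ((y i : ℝ) : ℂ) := fun i =>
    Complex.ofRealCLM.contDiff.comp (contDiff_apply ℝ ℝ i)
  exact (((contDiff_const.mul (h 0)).add (contDiff_const.mul (h 1))).mul contDiff_const).cexp

lemma isSmooth_re_character (k : Fin 2 → ℤ) : IsSmooth fun x => (character k x).re :=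
  Complex.reCLM.contDiff.comp (contDiff_character k)

lemma isSmooth_im_character (k : Fin 2 → ℤ) : IsSmooth fun x => (character k x).im :=
  Complex.imCLM.contDiff.comp (contDiff_character k)

lemma hasDerivAt_character (k : Fin 2 → ℤ) (i : Fin 2) (x : Torus) :
    HasDerivAt (fun t : ℝ => character k (x + Pi.single i (t : AddCircle (2 * π))))
      (Complex.I * k i * character k x) 0 := by
  simp_rw [character_add_arg, character_single_coe]
  have h := ((Complex.ofRealCLM.hasDerivAt (x := (0 : ℝ))).mul_const (Complex.I * (k i : ℂ)))
  have h2 := (h.cexp).const_mul (character k x)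
  simp only [Complex.ofRealCLM_apply, Complex.ofReal_zero, zero_mul, Complex.exp_zero,
    Complex.ofReal_one, one_mul] at h2
  rwa [mul_comm (character k x) (Complex.I * k i)] at h2

lemma partialDeriv_re_character (k : Fin 2 → ℤ) (i : Fin 2) (x : Torus) :
    partialDeriv i (fun x => (character k x).re) x = (Complex.I * k i * character k x).re :=
  (Complex.reCLM.hasFDerivAt.comp_hasDerivAt (0 : ℝ) (hasDerivAt_character k i x)).deriv

lemma partialDeriv_im_character (k : Fin 2 → ℤ) (i : Fin 2) (x : Torus) :
    partialDeriv i (fun x => (character k x).im) x = (Complex.I * k i * character k x).im :=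
  (Complex.imCLM.hasFDerivAt.comp_hasDerivAt (0 : ℝ) (hasDerivAt_character k i x)).deriv

/-! ### Weak derivatives -/

/-- The Fourier coefficients of a weak derivative. -/
lemma HasWeakDeriv.fourierCoef {i : Fin 2} {u v : Torus → ℝ} (h : HasWeakDeriv i u v)
    (k : Fin 2 → ℤ) : fourierCoef v k = Complex.I * k i * CahnHilliard.fourierCoef u k := by
  obtain ⟨hu, hv, h⟩ := h
  have hre := h _ (isSmooth_re_character (-k))
  have him := h _ (isSmooth_im_character (-k))
  simp only [partialDeriv_re_character, partialDeriv_im_character] at hre him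
  have hiu := (integrable_mul_character hu (-k)).const_mul (Complex.I * ((-k) i : ℤ))
  have hiv := integrable_mul_character hv (-k)
  have hre' : ∀ f : Torus → ℂ, Integrable f → (∫ x, f x).re = ∫ x, (f x).re :=
    fun f hf => (integral_re hf).symm
  have him' : ∀ f : Torus → ℂ, Integrable f → (∫ x, f x).im = ∫ x, (f x).im :=
    fun f hf => (integral_im hf).symm
  -- Test functions are real, so the complex identity is assembled from those for cosine and sine.
  have key : ∫ x, Complex.I * ((-k) i : ℤ) * ((u x : ℂ) * character (-k) x)
      = - ∫ x, (v x : ℂ) * character (-k) x := by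
    have hcomm : ∀ x, Complex.I * ((-k) i : ℤ) * ((u x : ℂ) * character (-k) x)
        = (u x : ℂ) * (Complex.I * ((-k) i : ℤ) * character (-k) x) := fun x => by ring
    apply Complex.ext
    · rw [hre' _ hiu, Complex.neg_re, hre' _ hiv]
      simp_rw [hcomm, Complex.re_ofReal_mul]
      exact hre
    · rw [him' _ hiu, Complex.neg_im, him' _ hiv]
      simp_rw [hcomm, Complex.im_ofReal_mul]
      exact him
  rw [integral_const_mul] at key
  rw [CahnHilliard.fourierCoef, CahnHilliard.fourierCoef, ← neg_eq_iff_eq_neg.2 key]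
  push_cast [Pi.neg_apply]
  ring

/-- Integration by parts from translation invariance: the integral of e_k(x) φ(x + t eᵢ) equals
exp(-i kᵢ t) times its value at t = 0. Differentiating both expressions at t = 0 gives the identity.
-/
lemma integral_character_mul_partialDeriv {φ : Torus → ℝ} (hφ : IsSmooth φ) (i : Fin 2)
    (k : Fin 2 → ℤ) :
    ∫ x, character k x * (partialDeriv i φ x : ℂ)
      = - ∫ x, Complex.I * k i * character k x * (φ x : ℂ) := by
  have hc := hφ.continuous_partialDeriv i
  obtain ⟨C, hC⟩ := isCompact_univ.exists_bound_of_continuousOn hc.continuousOn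
  set F : ℝ → Torus → ℂ := fun t x =>
    character k x * (φ (x + Pi.single i (t : AddCircle (2 * π))) : ℂ) with hF
  set F' : ℝ → Torus → ℂ := fun t x =>
    character k x * (partialDeriv i φ (x + Pi.single i (t : AddCircle (2 * π))) : ℂ) with hF'
  have hFc : ∀ t, Continuous (F t) := fun t => (continuous_character k).mul
    (Complex.continuous_ofReal.comp (hφ.continuous.comp (continuous_id.add continuous_const)))
  have hFc' : ∀ t, Continuous (F' t) := fun t => (continuous_character k).mul
    (Complex.continuous_ofReal.comp (hc.comp (continuous_id.add continuous_const)))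
  have hbound : ∀ x, ∀ t ∈ Set.univ, ‖F' t x‖ ≤ C := fun x t _ => by
    rw [hF', norm_mul, norm_character, one_mul, Complex.norm_real]
    exact hC _ (Set.mem_univ _)
  have hderiv : ∀ x, ∀ t ∈ Set.univ, HasDerivAt (fun t => F t x) (F' t x) t :=
    fun x t _ => (hφ.hasDerivAt x i t).ofReal_comp.const_mul _
  have hd : HasDerivAt (fun t => ∫ x, F t x) (∫ x, F' 0 x) 0 :=
    (hasDerivAt_integral_of_dominated_loc_of_deriv_le (μ := (volume : Measure Torus))
      (bound := fun _ => C) Filter.univ_mem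
      (Filter.Eventually.of_forall fun t => (hFc t).aestronglyMeasurable)
      (integrable_of_continuous (hFc 0)) (hFc' 0).aestronglyMeasurable
      (Filter.Eventually.of_forall hbound) (integrable_const C)
      (Filter.Eventually.of_forall hderiv)).2
  have htrans : ∀ t : ℝ, ∫ x, F t x
      = Complex.exp (t * (-(Complex.I * k i))) * ∫ x, character k x * (φ x : ℂ) := by
    intro t
    rw [← integral_add_right_eq_self (fun x => character k x * (φ x : ℂ))
      (Pi.single i (t : AddCircle (2 * π))), ← integral_const_mul]
    congr 1; ext x
    rw [character_add_arg, character_single_coe, mul_neg, Complex.exp_neg, hF]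
    have := Complex.exp_ne_zero (t * (Complex.I * k i))
    field_simp
  have hd2 : HasDerivAt (fun t : ℝ => Complex.exp (t * (-(Complex.I * k i))) *
      ∫ x, character k x * (φ x : ℂ)) (-(Complex.I * k i) * ∫ x, character k x * (φ x : ℂ)) 0 := by
    have h := ((Complex.ofRealCLM.hasDerivAt (x := (0 : ℝ))).mul_const (-(Complex.I * (k i : ℂ))))
    have h2 := h.cexp.mul_const (∫ x, character k x * (φ x : ℂ))
    simpa only [Complex.ofRealCLM_apply, Complex.ofReal_zero, zero_mul, Complex.exp_zero,
      Complex.ofReal_one, one_mul] using h2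
  rw [funext htrans] at hd
  have h4 := hd.unique hd2
  simp only [hF', AddCircle.coe_zero, Pi.single_zero, add_zero] at h4
  rw [h4, neg_mul, ← integral_const_mul]
  congr 2; ext x; ring

lemma exists_hasWeakDeriv_of_mem_trigSpace {N : ℕ} {u : Torus → ℝ} (hu : u ∈ trigSpace N)
    (i : Fin 2) : ∃ v, HasWeakDeriv i u v ∧ Continuous v := by
  have hint : ∀ {u φ : Torus → ℝ}, Continuous u → Continuous φ →
      Integrable (fun x => u x * φ x) := fun hu hφ => integrable_of_continuous (hu.mul hφ)
  suffices h : ∃ v, (∀ φ : Torus → ℝ, IsSmooth φ →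
      ∫ x, u x * partialDeriv i φ x = - ∫ x, v x * φ x) ∧ Continuous v by
    obtain ⟨v, hv, hvc⟩ := h
    exact ⟨v, ⟨integrable_of_continuous (continuous_of_mem_trigSpace hu),
      integrable_of_continuous hvc, hv⟩, hvc⟩
  have hu' := hu
  unfold trigSpace at hu
  induction hu using Submodule.span_induction with
  | mem g hg =>
    obtain ⟨k, hk, hg⟩ := hg
    have hdc : Continuous fun x => Complex.I * k i * character k x :=
      continuous_const.mul (continuous_character k)
    have hi1 : ∀ φ, IsSmooth φ →
        Integrable fun x => character k x * (partialDeriv i φ x : ℂ) := fun φ hφ =>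
      integrable_of_continuous ((continuous_character k).mul
        (Complex.continuous_ofReal.comp (hφ.continuous_partialDeriv i)))
    have hi2 : ∀ φ, IsSmooth φ →
        Integrable fun x => Complex.I * k i * character k x * (φ x : ℂ) := fun φ hφ =>
      integrable_of_continuous (hdc.mul (Complex.continuous_ofReal.comp hφ.continuous))
    rcases hg with rfl | rfl
    · refine ⟨fun x => (Complex.I * k i * character k x).re, fun φ hφ => ?_,
        Complex.continuous_re.comp hdc⟩
      have h := congrArg Complex.re (integral_character_mul_partialDeriv hφ i k)
      rw [Complex.neg_re] at h
      have e1 := integral_re (hi1 φ hφ)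
      have e2 := integral_re (hi2 φ hφ)
      simp only [RCLike.re_to_complex, Complex.re_mul_ofReal] at e1 e2
      rw [e1, e2, h]
    · refine ⟨fun x => (Complex.I * k i * character k x).im, fun φ hφ => ?_,
        Complex.continuous_im.comp hdc⟩
      have h := congrArg Complex.im (integral_character_mul_partialDeriv hφ i k)
      rw [Complex.neg_im] at h
      have e1 := integral_im (hi1 φ hφ)
      have e2 := integral_im (hi2 φ hφ)
      simp only [RCLike.im_to_complex, Complex.im_mul_ofReal] at e1 e2
      rw [e1, e2, h]
  | zero => exact ⟨0, fun φ _ => by simp, continuous_zero⟩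
  | add f g hfm hgm hf hg =>
    have hfc := continuous_of_mem_trigSpace (N := N) hfm
    have hgc := continuous_of_mem_trigSpace (N := N) hgm
    obtain ⟨a, ha, hac⟩ := hf hfm
    obtain ⟨b, hb, hbc⟩ := hg hgm
    refine ⟨fun x => a x + b x, fun φ hφ => ?_, hac.add hbc⟩
    have hp := hφ.continuous_partialDeriv i
    simp only [Pi.add_apply, add_mul]
    rw [integral_add (hint hfc hp) (hint hgc hp), ha φ hφ, hb φ hφ,
      integral_add (hint hac hφ.continuous) (hint hbc hφ.continuous)]
    ring
  | smul r f hfm hf =>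
    obtain ⟨a, ha, hac⟩ := hf hfm
    refine ⟨fun x => r * a x, fun φ hφ => ?_, continuous_const.mul hac⟩
    simp only [Pi.smul_apply, smul_eq_mul, mul_assoc]
    rw [integral_const_mul, integral_const_mul, ha φ hφ]
    ring

lemma memLp_of_continuous {E : Type*} [NormedAddCommGroup E] {f : Torus → E} (hf : Continuous f)
    (p : ENNReal) : MemLp f p := by
  obtain ⟨C, hC⟩ := isCompact_univ.exists_bound_of_continuousOn hf.continuousOn
  exact MemLp.of_bound hf.aestronglyMeasurable C
    (Filter.Eventually.of_forall fun x => hC x (Set.mem_univ x))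

lemma weakDeriv_spec {i : Fin 2} {u : Torus → ℝ}
    (h : ∃ v : Torus → ℝ, HasWeakDeriv i u v ∧ MemLp v 2 volume) :
    HasWeakDeriv i u (weakDeriv i u) ∧ MemLp (weakDeriv i u) 2 volume := by
  rw [weakDeriv, dif_pos h]
  exact h.choose_spec

/-- `weakDeriv` is an arbitrary representative, known only through its coefficients i kᵢ û(k). These
vanish off the box, so by completeness it agrees almost everywhere with its own truncation, to which
Parseval applies. -/
lemma integral_weakDeriv_sq {N : ℕ} {u : Torus → ℝ} (hu : u ∈ trigSpace N) (i : Fin 2) :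
    Integrable (fun x => weakDeriv i u x ^ 2) ∧
    ∫ x, weakDeriv i u x ^ 2 =
      ((2 * π) ^ 2)⁻¹ * ∑ k ∈ freqBox N, (k i : ℝ) ^ 2 * ‖fourierCoef u k‖ ^ 2 := by
  obtain ⟨v, hv, hvc⟩ := exists_hasWeakDeriv_of_mem_trigSpace hu i
  obtain ⟨hd, hd2⟩ := weakDeriv_spec ⟨v, hv, memLp_of_continuous hvc 2⟩
  set d := weakDeriv i u with hddef
  refine ⟨hd2.integrable_sq, ?_⟩
  have hp := fourierProj_mem_trigSpace N d
  have hae : d =ᵐ[volume] fourierProj N d := by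
    refine ae_eq_of_fourierCoef_eq hd2
      (memLp_of_continuous (continuous_of_mem_trigSpace hp) 2) fun k => ?_
    rw [fourierCoef_fourierProj]
    split_ifs with hk
    · rfl
    · rw [hd.fourierCoef, fourierCoef_eq_zero_of_mem_trigSpace hu hk, mul_zero]
  have h1 : ∫ x, d x ^ 2 = ∫ x, fourierProj N d x ^ 2 := by
    refine integral_congr_ae ?_
    filter_upwards [hae] with x hx
    rw [← hx]
  rw [h1, integral_sq_of_mem_trigSpace hp]
  congr 1
  refine Finset.sum_congr rfl fun k hk => ?_
  rw [fourierCoef_fourierProj, if_pos hk, hd.fourierCoef]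
  simp [mul_pow]

/-- The energy of a trigonometric polynomial. -/
lemma energy_of_mem_trigSpace (ν : ℝ) {N : ℕ} {u : Torus → ℝ} (hu : u ∈ trigSpace N) :
    energy ν u = ν / 2 * (((2 * π) ^ 2)⁻¹ * ∑ k ∈ freqBox N, freqSq k * ‖fourierCoef u k‖ ^ 2)
      + ∫ x, doubleWell (u x) := by
  have hF : Integrable fun x => doubleWell (u x) := by
    refine integrable_of_continuous ?_
    have := continuous_of_mem_trigSpace hu
    unfold doubleWell
    fun_prop
  have hw := fun i => integral_weakDeriv_sq hu i
  rw [energy, integral_add ((integrable_finsetSum _ fun i _ => (hw i).1).const_mul _) hF,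
    integral_const_mul, integral_finsetSum _ fun i _ => (hw i).1]
  simp only [(hw _).2, ← Finset.mul_sum]
  rw [Finset.sum_comm]
  simp only [freqSq, Finset.sum_mul]

/-! ### Boundedness of the Fourier truncation in `L⁴` -/

/-- If g is small compared with h, then g - h is close to -h and h² conj(g - h)² is close to |h|⁴.
The errors are of the form |h|³|g| and |h|²|g|², and Young's inequality absorbs them; 50 is not
optimized. -/
lemma norm_pow_four_le (h g : ℂ) :
    ‖h‖ ^ 4 ≤ 2 * (h ^ 2 * conj (g - h) ^ 2).re + 50 * ‖g‖ ^ 4 := by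
  have h1 : h ^ 2 * conj (g - h) ^ 2 = (h * conj g - ((‖h‖ ^ 2 : ℝ) : ℂ)) ^ 2 := by
    rw [← Complex.normSq_eq_norm_sq, ← Complex.mul_conj, map_sub]
    ring
  have h2 : ‖h * conj g‖ = ‖h‖ * ‖g‖ := by rw [norm_mul, RCLike.norm_conj]
  rw [h1]
  set z := h * conj g
  have hz1 : z.re ≤ ‖h‖ * ‖g‖ := h2 ▸ Complex.re_le_norm z
  have hz2 : z.re ^ 2 + z.im ^ 2 = (‖h‖ * ‖g‖) ^ 2 := by
    rw [← h2, ← Complex.normSq_eq_norm_sq, Complex.normSq_apply]; ring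
  have hre : ((z - ((‖h‖ ^ 2 : ℝ) : ℂ)) ^ 2).re = (z.re - ‖h‖ ^ 2) ^ 2 - z.im ^ 2 := by
    rw [sq, Complex.mul_re, Complex.sub_re, Complex.sub_im, Complex.ofReal_re, Complex.ofReal_im]
    ring
  rw [hre]
  set a := ‖h‖
  set b := ‖g‖
  have h3 : a ^ 2 * z.re ≤ a ^ 2 * (a * b) := mul_le_mul_of_nonneg_left hz1 (sq_nonneg _)
  nlinarith [sq_nonneg (a ^ 2 - 2 * (a * b) - 5 * b ^ 2), sq_nonneg (b * (2 * a - 5 * b)),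
    sq_nonneg z.re]

/-- If `h² k̄²` has mean zero then `h` is controlled by `h + k` in `L⁴`. -/
lemma integral_norm_pow_four_le {h g : Torus → ℂ} (hh : Continuous h) (hg : Continuous g)
    (h0 : ∫ x, h x ^ 2 * conj (g x - h x) ^ 2 = 0) :
    ∫ x, ‖h x‖ ^ 4 ≤ 50 * ∫ x, ‖g x‖ ^ 4 := by
  have hc : Continuous fun x => h x ^ 2 * conj (g x - h x) ^ 2 :=
    (hh.pow 2).mul ((Complex.continuous_conj.comp (hg.sub hh)).pow 2)
  have hi := integrable_of_continuous hc
  have hre : ∫ x, (h x ^ 2 * conj (g x - h x) ^ 2).re = 0 := by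
    have := integral_re hi
    simp only [RCLike.re_to_complex] at this
    rw [this, h0, Complex.zero_re]
  have hi1 : Integrable fun x => 2 * (h x ^ 2 * conj (g x - h x) ^ 2).re :=
    integrable_of_continuous (continuous_const.mul (Complex.continuous_re.comp hc))
  have hi2 : Integrable fun x => 50 * ‖g x‖ ^ 4 :=
    integrable_of_continuous (continuous_const.mul (hg.norm.pow 4))
  calc ∫ x, ‖h x‖ ^ 4
      ≤ ∫ x, (2 * (h x ^ 2 * conj (g x - h x) ^ 2).re + 50 * ‖g x‖ ^ 4) :=
        integral_mono (integrable_of_continuous (hh.norm.pow 4)) (hi1.add hi2)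
          fun x => norm_pow_four_le _ _
    _ = 50 * ∫ x, ‖g x‖ ^ 4 := by
        rw [integral_add hi1 hi2, integral_const_mul, integral_const_mul, hre]
        ring

/-- Every frequency a + b - p - q in the expanded product has positive i-th component, so the zero
mode is absent. -/
lemma integral_sq_mul_conj_sq_eq_zero {s t : Finset (Fin 2 → ℤ)} (c : (Fin 2 → ℤ) → ℂ)
    (i : Fin 2) (m : ℤ) (hs : ∀ k ∈ s, m ≤ k i) (ht : ∀ k ∈ t, k i < m) :
    ∫ x, trigSum s c x ^ 2 * conj (trigSum t c x) ^ 2 = 0 := by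
  have h : ∀ x, trigSum s c x ^ 2 * conj (trigSum t c x) ^ 2
      = ∑ a ∈ s, ∑ b ∈ s, ∑ p ∈ t, ∑ q ∈ t,
        c a * c b * conj (c p) * conj (c q) * character (a + b + -p + -q) x := by
    intro x
    simp only [sq, trigSum, map_sum, Finset.sum_mul_sum]
    refine Finset.sum_congr rfl fun a _ => ?_
    rw [Finset.sum_comm]
    refine Finset.sum_congr rfl fun b _ => ?_
    refine Finset.sum_congr rfl fun p _ => ?_
    refine Finset.sum_congr rfl fun q _ => ?_
    rw [character_add, character_add, character_add, character_neg, character_neg, map_mul,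
      map_mul]
    ring
  have hi : ∀ a b p q : Fin 2 → ℤ, Integrable fun x =>
      c a * c b * conj (c p) * conj (c q) * character (a + b + -p + -q) x := fun a b p q =>
    (integrable_of_continuous (continuous_character _)).const_mul _
  simp_rw [h]
  rw [integral_finsetSum _ fun a _ => integrable_finsetSum _ fun b _ =>
    integrable_finsetSum _ fun p _ => integrable_finsetSum _ fun q _ => hi a b p q]
  refine Finset.sum_eq_zero fun a ha => ?_
  rw [integral_finsetSum _ fun b _ =>
    integrable_finsetSum _ fun p _ => integrable_finsetSum _ fun q _ => hi a b p q]
  refine Finset.sum_eq_zero fun b hb => ?_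
  rw [integral_finsetSum _ fun p _ => integrable_finsetSum _ fun q _ => hi a b p q]
  refine Finset.sum_eq_zero fun p hp => ?_
  rw [integral_finsetSum _ fun q _ => hi a b p q]
  refine Finset.sum_eq_zero fun q hq => ?_
  rw [integral_const_mul, integral_character, if_neg, mul_zero]
  intro h0
  have h1 := congrFun h0 i
  simp only [Pi.add_apply, Pi.neg_apply, Pi.zero_apply] at h1
  have := hs a ha; have := hs b hb; have := ht p hp; have := ht q hq
  omega

lemma trigSum_filter_add (s : Finset (Fin 2 → ℤ)) (c : (Fin 2 → ℤ) → ℂ)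
    (p : (Fin 2 → ℤ) → Prop) [DecidablePred p] (x : Torus) :
    trigSum (s.filter p) c x + trigSum (s.filter fun k => ¬ p k) c x = trigSum s c x :=
  Finset.sum_filter_add_sum_filter_not _ _ _

/-- Truncation to an upper half space of frequencies is bounded in `L⁴`. -/
lemma integral_norm_trigSum_ge_le (s : Finset (Fin 2 → ℤ)) (c : (Fin 2 → ℤ) → ℂ) (i : Fin 2)
    (m : ℤ) : ∫ x, ‖trigSum (s.filter fun k => m ≤ k i) c x‖ ^ 4
      ≤ 50 * ∫ x, ‖trigSum s c x‖ ^ 4 := by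
  refine integral_norm_pow_four_le (continuous_trigSum _ _) (continuous_trigSum _ _) ?_
  simp_rw [← trigSum_filter_add s c (fun k => m ≤ k i), add_sub_cancel_left]
  exact integral_sq_mul_conj_sq_eq_zero c i m (by simp) (by simp)

/-- Truncation to a lower half space of frequencies is bounded in `L⁴`. -/
lemma integral_norm_trigSum_lt_le (s : Finset (Fin 2 → ℤ)) (c : (Fin 2 → ℤ) → ℂ) (i : Fin 2)
    (m : ℤ) : ∫ x, ‖trigSum (s.filter fun k => ¬ m ≤ k i) c x‖ ^ 4
      ≤ 50 * ∫ x, ‖trigSum s c x‖ ^ 4 := by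
  refine integral_norm_pow_four_le (continuous_trigSum _ _) (continuous_trigSum _ _) ?_
  simp_rw [← trigSum_filter_add s c (fun k => m ≤ k i), add_sub_cancel_right]
  -- With the lower half as h and the upper half as g - h, the integrand is the conjugate of the one
  -- already known to have mean zero.
  have h := congrArg conj (integral_sq_mul_conj_sq_eq_zero (s := s.filter fun k => m ≤ k i)
    (t := s.filter fun k => ¬ m ≤ k i) c i m (by simp) (by simp))
  rw [← integral_conj, map_zero] at h
  rw [← h]
  congr 1; ext x
  simp [mul_comm]

lemma freqBox_eq_filter {N : ℕ} {s : Finset (Fin 2 → ℤ)} (h : freqBox N ⊆ s) :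
    freqBox N = (((s.filter fun k => -(N : ℤ) ≤ k 0).filter fun k => ¬ (N : ℤ) + 1 ≤ k 0).filter
      fun k => -(N : ℤ) ≤ k 1).filter fun k => ¬ (N : ℤ) + 1 ≤ k 1 := by
  ext k
  simp only [Finset.mem_filter]
  constructor
  · intro hk
    have := mem_freqBox.1 hk
    have h0 := abs_le.1 (this 0)
    have h1 := abs_le.1 (this 1)
    exact ⟨⟨⟨⟨h hk, h0.1⟩, by omega⟩, h1.1⟩, by omega⟩
  · rintro ⟨⟨⟨⟨_, h0⟩, h1⟩, h2⟩, h3⟩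
    rw [mem_freqBox]
    intro i
    rw [abs_le]
    fin_cases i
    · exact ⟨h0, by simpa using (by omega : k 0 ≤ N)⟩
    · exact ⟨h2, by simpa using (by omega : k 1 ≤ N)⟩

/-- The box is an intersection of four half-planes, each costing a factor 50, independently of N. -/
lemma integral_norm_trigSum_freqBox_le {N : ℕ} {s : Finset (Fin 2 → ℤ)} (h : freqBox N ⊆ s)
    (c : (Fin 2 → ℤ) → ℂ) :
    ∫ x, ‖trigSum (freqBox N) c x‖ ^ 4 ≤ 50 ^ 4 * ∫ x, ‖trigSum s c x‖ ^ 4 := by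
  rw [freqBox_eq_filter h]
  have h1 := integral_norm_trigSum_ge_le s c 0 (-(N : ℤ))
  have h2 := integral_norm_trigSum_lt_le (s.filter fun k => -(N : ℤ) ≤ k 0) c 0 ((N : ℤ) + 1)
  have h3 := integral_norm_trigSum_ge_le ((s.filter fun k => -(N : ℤ) ≤ k 0).filter
    fun k => ¬ (N : ℤ) + 1 ≤ k 0) c 1 (-(N : ℤ))
  have h4 := integral_norm_trigSum_lt_le (((s.filter fun k => -(N : ℤ) ≤ k 0).filter
    fun k => ¬ (N : ℤ) + 1 ≤ k 0).filter fun k => -(N : ℤ) ≤ k 1) c 1 ((N : ℤ) + 1)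
  linarith

lemma freqBox_mono : Monotone freqBox := by
  intro M N h k hk
  rw [mem_freqBox] at hk ⊢
  exact fun i => (hk i).trans (by exact_mod_cast h)

lemma integral_fourierProj_pow_four_le {M N : ℕ} (h : N ≤ M) (u : Torus → ℝ) :
    ∫ x, fourierProj N u x ^ 4 ≤ 50 ^ 4 * ∫ x, fourierProj M u x ^ 4 := by
  have hN : ∀ K x, fourierProj K u x ^ 4 = ‖trigSum (freqBox K)
      (fun k => (((2 * π) ^ 2)⁻¹ : ℝ) * fourierCoef u k) x‖ ^ 4 := by
    intro K x
    rw [← ofReal_fourierProj, Complex.norm_real, Real.norm_eq_abs, Even.pow_abs (by decide)]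
  simp_rw [hN]
  exact integral_norm_trigSum_freqBox_le (freqBox_mono h) _

lemma exists_subset_freqBox (s : Finset (Fin 2 → ℤ)) : ∃ N, s ⊆ freqBox N := by
  refine ⟨s.sup fun k => max (k 0).natAbs (k 1).natAbs, fun k hk => ?_⟩
  have h : max (k 0).natAbs (k 1).natAbs ≤ _ :=
    Finset.le_sup (f := fun k : Fin 2 → ℤ => max (k 0).natAbs (k 1).natAbs) hk
  rw [max_le_iff] at h
  rw [mem_freqBox]
  intro i
  rw [Int.abs_eq_natAbs, Int.ofNat_le]
  fin_cases i
  · exact h.1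
  · exact h.2

lemma tendsto_freqBox : Filter.Tendsto freqBox Filter.atTop Filter.atTop :=
  Filter.tendsto_atTop_finset_of_monotone freqBox_mono fun k =>
    (exists_subset_freqBox {k}).imp fun _ h => h (Finset.mem_singleton_self k)

/-! ### Absolutely convergent Fourier series -/

lemma abs_fourierProj_le (N : ℕ) (u : Torus → ℝ) (x : Torus) :
    |fourierProj N u x| ≤ ((2 * π) ^ 2)⁻¹ * ∑ k ∈ freqBox N, ‖fourierCoef u k‖ := by
  have h : |fourierProj N u x| = ‖(fourierProj N u x : ℂ)‖ := by
    rw [Complex.norm_real, Real.norm_eq_abs]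
  rw [h, ofReal_fourierProj, trigSum, Finset.mul_sum]
  refine (norm_sum_le _ _).trans (Finset.sum_le_sum fun k _ => ?_)
  rw [norm_mul, norm_mul, norm_character, mul_one, Complex.norm_real,
    Real.norm_of_nonneg (by positivity)]

/-- The series converges absolutely to some bounded U. Dominated convergence shows that U has the
coefficients of u, and completeness gives u = U almost everywhere. -/
lemma tendsto_fourierProj {u : Torus → ℝ} (hu : MemLp u 2)
    (hs : Summable fun k => ‖fourierCoef u k‖) :
    (∀ᵐ x, Filter.Tendsto (fun N => fourierProj N u x) Filter.atTop (nhds (u x))) ∧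
    ∃ C, ∀ N x, |fourierProj N u x| ≤ C := by
  set a : (Fin 2 → ℤ) → ℂ := fun k => (((2 * π) ^ 2)⁻¹ : ℝ) * fourierCoef u k with ha
  set C := ((2 * π) ^ 2)⁻¹ * ∑' k, ‖fourierCoef u k‖ with hC
  have hbound : ∀ N x, |fourierProj N u x| ≤ C := fun N x =>
    (abs_fourierProj_le N u x).trans (mul_le_mul_of_nonneg_left
      (hs.sum_le_tsum _ fun k _ => norm_nonneg _) (by positivity))
  refine ⟨?_, C, hbound⟩
  have hsum : ∀ x, Summable fun k => a k * character k x := fun x => by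
    refine Summable.of_norm_bounded (hs.mul_left ((2 * π) ^ 2)⁻¹) fun k => ?_
    rw [ha, norm_mul, norm_mul, norm_character, mul_one, Complex.norm_real,
      Real.norm_of_nonneg (by positivity)]
  set U : Torus → ℝ := fun x => (∑' k, a k * character k x).re with hU
  have hlim : ∀ x, Filter.Tendsto (fun N => fourierProj N u x) Filter.atTop (nhds (U x)) := by
    intro x
    have h1 := (Complex.continuous_re.tendsto _).comp ((hsum x).hasSum.comp tendsto_freqBox)
    refine h1.congr fun N => ?_
    have := congrArg Complex.re (ofReal_fourierProj N u x)
    rw [Complex.ofReal_re] at this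
    exact this.symm
  have hpc : ∀ N, Continuous (fourierProj N u) := fun N => continuous_laplaceFun _ _ _
  have hUm : AEStronglyMeasurable U := aestronglyMeasurable_of_tendsto_ae Filter.atTop
    (fun N => (hpc N).aestronglyMeasurable) (Filter.Eventually.of_forall hlim)
  have hUb : ∀ x, ‖U x‖ ≤ C := fun x =>
    le_of_tendsto (hlim x).norm (Filter.Eventually.of_forall fun N => hbound N x)
  have hU2 : MemLp U 2 := MemLp.of_bound hUm C (Filter.Eventually.of_forall hUb)
  have hcoef : ∀ k, fourierCoef u k = fourierCoef U k := by
    intro k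
    have h1 : Filter.Tendsto (fun N => fourierCoef (fourierProj N u) k) Filter.atTop
        (nhds (fourierCoef U k)) := by
      refine tendsto_integral_of_dominated_convergence (fun _ => C)
        (fun N => ((Complex.continuous_ofReal.comp (hpc N)).mul
          (continuous_character _)).aestronglyMeasurable) (integrable_const C)
        (fun N => Filter.Eventually.of_forall fun x => ?_)
        (Filter.Eventually.of_forall fun x => ?_)
      · rw [norm_mul, norm_character, mul_one, Complex.norm_real]
        exact hbound N x
      · exact ((Complex.continuous_ofReal.tendsto _).comp (hlim x)).mul_const _
    have h2 : Filter.Tendsto (fun N => fourierCoef (fourierProj N u) k) Filter.atTop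
        (nhds (fourierCoef u k)) := by
      obtain ⟨M, hM⟩ := exists_subset_freqBox {k}
      refine tendsto_const_nhds.congr' ?_
      filter_upwards [Filter.eventually_ge_atTop M] with N hN
      rw [fourierCoef_fourierProj, if_pos (freqBox_mono hN (hM (Finset.mem_singleton_self k)))]
    exact tendsto_nhds_unique h2 h1
  filter_upwards [ae_eq_of_fourierCoef_eq hu hU2 hcoef] with x hx
  rw [hx]
  exact hlim x

/-- The truncation at N is compared with that at M ≥ N, and M tends to infinity by dominated
convergence. -/
lemma integral_fourierProj_pow_four_le_of_summable {u : Torus → ℝ} (hu : MemLp u 2)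
    (hs : Summable fun k => ‖fourierCoef u k‖) (N : ℕ) :
    Integrable (fun x => u x ^ 4) ∧
    ∫ x, fourierProj N u x ^ 4 ≤ 50 ^ 4 * ∫ x, u x ^ 4 := by
  obtain ⟨hlim, C, hC⟩ := tendsto_fourierProj hu hs
  have hpow : ∀ N x, ‖fourierProj N u x ^ 4‖ ≤ C ^ 4 := fun N x => by
    rw [norm_pow]
    exact pow_le_pow_left₀ (norm_nonneg _) (hC N x) 4
  have hlim4 : ∀ᵐ x, Filter.Tendsto (fun N => fourierProj N u x ^ 4) Filter.atTop
      (nhds (u x ^ 4)) := hlim.mono fun x hx => hx.pow 4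
  have hpc : ∀ N, Continuous (fourierProj N u) := fun N => continuous_laplaceFun _ _ _
  refine ⟨Integrable.of_bound (hu.1.pow 4) (C ^ 4) ?_, ?_⟩
  · filter_upwards [hlim4] with x hx
    exact le_of_tendsto hx.norm (Filter.Eventually.of_forall fun N => hpow N x)
  · have h1 : Filter.Tendsto (fun M => ∫ x, fourierProj M u x ^ 4) Filter.atTop
        (nhds (∫ x, u x ^ 4)) :=
      tendsto_integral_of_dominated_convergence (fun _ => C ^ 4)
        (fun N => ((hpc N).pow 4).aestronglyMeasurable) (integrable_const _)
        (fun N => Filter.Eventually.of_forall fun x => hpow N x) hlim4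
    refine ge_of_tendsto (h1.const_mul _) ?_
    filter_upwards [Filter.eventually_ge_atTop N] with M hM
    exact integral_fourierProj_pow_four_le hM u

/-- The Fourier coefficients of an `H²` function are absolutely summable. -/
lemma summable_fourierCoef_of_memSobolev {u : Torus → ℝ} (hu : MemSobolev 2 u) :
    Summable fun k => ‖fourierCoef u k‖ := by
  have h4 : ∀ i : Fin 2, Summable fun k : Fin 2 → ℤ =>
      (k i : ℝ) ^ 4 * ‖fourierCoef u k‖ ^ 2 := by
    intro i
    obtain ⟨v, hv, hv1⟩ := hu.2 i
    obtain ⟨w, hw, hw2⟩ := hv1.2 i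
    have hw2 : MemLp w 2 := hw2
    refine summable_of_sum_le (c := (2 * π) ^ 2 * ∫ x, w x ^ 2) (fun k => by positivity)
      fun s => ?_
    obtain ⟨M, hM⟩ := exists_subset_freqBox s
    refine le_trans ?_ (sum_sq_fourierCoef_le hw2 M)
    refine (Finset.sum_le_sum_of_subset_of_nonneg hM fun k _ _ => by positivity).trans
      (Finset.sum_le_sum fun k _ => le_of_eq ?_)
    rw [hw.fourierCoef, hv.fourierCoef]
    simp only [norm_mul, Complex.norm_I, Complex.norm_intCast, one_mul, mul_pow, sq_abs]
    ring
  have hz := EisensteinSeries.summable_one_div_norm_rpow (k := 4) (by norm_num)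
  refine Summable.of_norm_bounded_eventually (((h4 0).add (h4 1)).add hz) ?_
  have hne : ∀ᶠ k : Fin 2 → ℤ in Filter.cofinite, k ≠ 0 :=
    (Set.finite_singleton (0 : Fin 2 → ℤ)).eventually_cofinite_notMem
  filter_upwards [hne] with k hk
  rw [norm_norm]
  have hk' : 0 < ‖k‖ := norm_pos_iff.2 hk
  have hr : ‖k‖ ^ (-4 : ℝ) = (‖k‖ ^ 4)⁻¹ := by
    rw [Real.rpow_neg hk'.le]; norm_cast
  have hmax : ‖k‖ ^ 4 ≤ (k 0 : ℝ) ^ 4 + (k 1 : ℝ) ^ 4 := by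
    rw [EisensteinSeries.norm_eq_max_natAbs]
    have e : ∀ n : ℤ, ((n.natAbs : ℕ) : ℝ) ^ 4 = (n : ℝ) ^ 4 := fun n => by
      rw [Nat.cast_natAbs, Int.cast_abs, Even.pow_abs (by decide)]
    rcases max_cases (k 0).natAbs (k 1).natAbs with h | h <;> rw [h.1, e] <;>
      nlinarith [sq_nonneg ((k 0 : ℝ) ^ 2), sq_nonneg ((k 1 : ℝ) ^ 2)]
  rw [hr]
  set r := ‖k‖ ^ 4
  set y := ‖fourierCoef u k‖
  have hrpos : 0 < r := by positivity
  -- Young's inequality splits |û(k)| into a part summable because second derivatives are in L² and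
  -- ‖k‖⁻⁴, summable on ℤ².
  have h1 : y ≤ r * y ^ 2 + r⁻¹ := by
    have e1 : r * y ^ 2 + r⁻¹ - y = r⁻¹ * ((r * y - 1 / 2) ^ 2 + 3 / 4) := by
      field_simp; ring
    have : 0 ≤ r * y ^ 2 + r⁻¹ - y := by rw [e1]; positivity
    linarith
  nlinarith [mul_le_mul_of_nonneg_right hmax (sq_nonneg y)]

/-! ### The energy of the truncated initial value -/

lemma integral_one_torus : ∫ _ : Torus, (1 : ℝ) = (2 * π) ^ 2 := by
  have h := integral_character 0
  simp only [character_zero, if_true] at h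
  have h2 : ∫ _ : Torus, ((1 : ℝ) : ℂ) = ((2 * π) ^ 2 : ℝ) := by
    rw [← h]; simp
  rw [integral_complex_ofReal] at h2
  exact_mod_cast h2

lemma doubleWell_nonneg (r : ℝ) : 0 ≤ doubleWell r := by
  unfold doubleWell; positivity

lemma two_pi_sq_le : (2 * π) ^ 2 ≤ 40 := by
  nlinarith [Real.pi_lt_d2, Real.pi_pos]

/-- Bessel handles the gradient. The potential passes through L⁴ by F(p) ≤ (p⁴ + 1)/4 and u⁴ ≤ 8F(u)
+ 2. With (2π)² ≤ 40 the additive constants are 20·50⁴ + 10, which is below 21·50⁴. -/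
lemma energy_fourierProj_le {ν : ℝ} (hν : 0 < ν) {u : Torus → ℝ} (hu : MemSobolev 2 u) (N : ℕ) :
    0 ≤ energy ν u ∧ energy ν (fourierProj N u) ≤ 50 ^ 4 * (2 * energy ν u + 21) := by
  obtain ⟨h4, hproj⟩ := integral_fourierProj_pow_four_le_of_summable hu.1
    (summable_fourierCoef_of_memSobolev hu) N
  have hi1 : Integrable fun _ : Torus => (1 : ℝ) := integrable_const _
  have hw : ∀ i : Fin 2, HasWeakDeriv i u (weakDeriv i u) ∧ MemLp (weakDeriv i u) 2 := fun i => by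
    obtain ⟨v, hv, hv1⟩ := hu.2 i
    exact weakDeriv_spec ⟨v, hv, hv1.1⟩
  have hF : Integrable fun x => doubleWell (u x) := by
    have h2 : Integrable fun x => u x ^ 2 := hu.1.integrable_sq
    refine (((h4.sub (h2.const_mul 2)).add hi1).div_const 4).congr
      (Filter.Eventually.of_forall fun x => ?_)
    simp only [Pi.add_apply, Pi.sub_apply, doubleWell]
    ring
  have hsum : Integrable fun x => ∑ i, weakDeriv i u x ^ 2 :=
    integrable_finsetSum _ fun i _ => (hw i).2.integrable_sq
  have hE : energy ν u = ν / 2 * ∑ i, (∫ x, weakDeriv i u x ^ 2) + ∫ x, doubleWell (u x) := by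
    rw [energy, integral_add (hsum.const_mul _) hF, integral_const_mul,
      integral_finsetSum _ fun i _ => (hw i).2.integrable_sq]
  have hG : 0 ≤ ν / 2 * ∑ i, ∫ x, weakDeriv i u x ^ 2 := by
    have : 0 ≤ ∑ i, ∫ x, weakDeriv i u x ^ 2 :=
      Finset.sum_nonneg fun i _ => integral_nonneg fun x => sq_nonneg _
    positivity
  have hF0 : 0 ≤ ∫ x, doubleWell (u x) := integral_nonneg fun x => doubleWell_nonneg _
  refine ⟨by rw [hE]; positivity, ?_⟩
  have hp := fourierProj_mem_trigSpace N u
  have hpc := continuous_of_mem_trigSpace hp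
  rw [energy_of_mem_trigSpace ν hp]
  have hgrad : ((2 * π) ^ 2)⁻¹ * ∑ k ∈ freqBox N, freqSq k * ‖fourierCoef (fourierProj N u) k‖ ^ 2
      ≤ ∑ i, ∫ x, weakDeriv i u x ^ 2 := by
    rw [inv_mul_le_iff₀ (by positivity), Finset.mul_sum]
    have e : ∑ k ∈ freqBox N, freqSq k * ‖fourierCoef (fourierProj N u) k‖ ^ 2
        = ∑ i, ∑ k ∈ freqBox N, ‖fourierCoef (weakDeriv i u) k‖ ^ 2 := by
      rw [Finset.sum_comm]
      refine Finset.sum_congr rfl fun k hk => ?_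
      rw [fourierCoef_fourierProj, if_pos hk, freqSq, Finset.sum_mul]
      refine Finset.sum_congr rfl fun i _ => ?_
      rw [(hw i).1.fourierCoef]
      simp [mul_pow]
    rw [e]
    exact Finset.sum_le_sum fun i _ => sum_sq_fourierCoef_le (hw i).2 N
  have hpot : ∫ x, doubleWell (fourierProj N u x)
      ≤ 4⁻¹ * (∫ x, fourierProj N u x ^ 4) + 4⁻¹ * (2 * π) ^ 2 := by
    have hp4 : Integrable fun x => fourierProj N u x ^ 4 := integrable_of_continuous (hpc.pow 4)
    rw [← integral_one_torus, ← integral_const_mul, ← integral_const_mul,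
      ← integral_add (hp4.const_mul _) (hi1.const_mul _)]
    refine integral_mono (integrable_of_continuous ?_) ((hp4.const_mul _).add (hi1.const_mul _))
      fun x => ?_
    · unfold doubleWell; fun_prop
    · simp only [doubleWell]
      nlinarith [sq_nonneg (fourierProj N u x)]
  have hu4 : ∫ x, u x ^ 4 ≤ 8 * (∫ x, doubleWell (u x)) + 2 * (2 * π) ^ 2 := by
    rw [← integral_one_torus, ← integral_const_mul, ← integral_const_mul,
      ← integral_add (hF.const_mul _) (hi1.const_mul _)]
    refine integral_mono h4 ((hF.const_mul _).add (hi1.const_mul _)) fun x => ?_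
    simp only [doubleWell]
    nlinarith [sq_nonneg (u x ^ 2 - 2)]
  have hgrad' := mul_le_mul_of_nonneg_left hgrad (by positivity : 0 ≤ ν / 2)
  have := two_pi_sq_le
  rw [hE]
  linarith

/-! ### The logarithmic Sobolev-type bound on `X_N` -/

lemma card_freqBox (N : ℕ) : (freqBox N).card = (2 * N + 1) ^ 2 := by
  rw [freqBox, Fintype.card_piFinset_const, Int.card_Icc]
  congr 1
  omega

/-- The shell |k|_∞ = n has 8n points, each with |k|² ≥ n², so it contributes at most 8/n. The zero
mode contributes 0 because 0⁻¹ = 0. -/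
lemma sum_inv_freqSq_le_harmonic (N : ℕ) :
    ∑ k ∈ freqBox N, (freqSq k)⁻¹ ≤ 8 * (harmonic N : ℝ) := by
  induction N with
  | zero =>
    have h : freqBox 0 = {0} := by
      ext k
      simp [mem_freqBox, funext_iff]
    simp [h, freqSq_zero]
  | succ N ih =>
    have hsub : freqBox N ⊆ freqBox (N + 1) := freqBox_mono N.le_succ
    have hcard : ((freqBox (N + 1) \ freqBox N).card : ℝ) = 8 * (N + 1) := by
      rw [Finset.card_sdiff_of_subset hsub, Nat.cast_sub (Finset.card_le_card hsub),
        card_freqBox, card_freqBox]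
      push_cast
      ring
    have hle : ∑ k ∈ freqBox (N + 1) \ freqBox N, (freqSq k)⁻¹ ≤ 8 * ((N : ℝ) + 1)⁻¹ := by
      have h1 : ∀ k ∈ freqBox (N + 1) \ freqBox N, (freqSq k)⁻¹ ≤ (((N : ℝ) + 1) ^ 2)⁻¹ := by
        intro k hk
        rw [Finset.mem_sdiff, mem_freqBox (N := N)] at hk
        obtain ⟨-, hk⟩ := hk
        push Not at hk
        obtain ⟨i, hi⟩ := hk
        have h2 : (N : ℝ) + 1 ≤ |(k i : ℝ)| := by exact_mod_cast hi
        have h3 : ((N : ℝ) + 1) ^ 2 ≤ (k i : ℝ) ^ 2 := by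
          rw [← sq_abs (k i : ℝ)]
          exact pow_le_pow_left₀ (by positivity) h2 2
        have h4 : (k i : ℝ) ^ 2 ≤ freqSq k :=
          Finset.single_le_sum (f := fun i => (k i : ℝ) ^ 2) (fun _ _ => sq_nonneg _)
            (Finset.mem_univ i)
        exact inv_anti₀ (by positivity) (h3.trans h4)
      refine (Finset.sum_le_card_nsmul _ _ _ h1).trans (le_of_eq ?_)
      rw [nsmul_eq_mul, hcard]
      field_simp
    rw [← Finset.sum_sdiff hsub, harmonic_succ]
    push_cast
    linarith

lemma half_le_log {N : ℕ} (hN : 2 ≤ N) : 1 / 2 ≤ Real.log N := by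
  have h1 : Real.log 2 ≤ Real.log N := Real.log_le_log (by norm_num) (by exact_mod_cast hN)
  linarith [Real.log_two_gt_d9]

/-- Since log N ≥ 1/2, the 1 in the harmonic bound is at most 2 log N, whence 24 = 8·3. -/
lemma sum_inv_freqSq_le {N : ℕ} (hN : 2 ≤ N) :
    ∑ k ∈ freqBox N, (freqSq k)⁻¹ ≤ 24 * Real.log N := by
  have h1 := sum_inv_freqSq_le_harmonic N
  have h2 := harmonic_le_one_add_log N
  have h3 := half_le_log hN
  linarith

lemma zero_mem_freqBox (N : ℕ) : (0 : Fin 2 → ℤ) ∈ freqBox N := by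
  simp [mem_freqBox]

/-- The Cauchy–Schwarz inequality against `∑ |k|⁻²`. -/
lemma sq_sum_erase_le {N : ℕ} (hN : 2 ≤ N) (c : (Fin 2 → ℤ) → ℝ) :
    (∑ k ∈ (freqBox N).erase 0, c k) ^ 2
      ≤ 24 * Real.log N * ∑ k ∈ freqBox N, freqSq k * c k ^ 2 := by
  have hnn : ∀ k, 0 ≤ freqSq k := freqSq_nonneg
  have h1 : (∑ k ∈ (freqBox N).erase 0, c k) ^ 2 ≤ (∑ k ∈ (freqBox N).erase 0, (freqSq k)⁻¹) *
      ∑ k ∈ (freqBox N).erase 0, freqSq k * c k ^ 2 := by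
    refine Finset.sum_sq_le_sum_mul_sum_of_sq_le_mul _ (fun k _ => inv_nonneg.2 (hnn k))
      (fun k _ => mul_nonneg (hnn k) (sq_nonneg _)) fun k hk => le_of_eq ?_
    have := one_le_freqSq (Finset.ne_of_mem_erase hk)
    field_simp
  refine h1.trans (mul_le_mul ?_ ?_ ?_ ?_)
  · exact (Finset.sum_le_sum_of_subset_of_nonneg (Finset.erase_subset _ _)
      fun k _ _ => inv_nonneg.2 (hnn k)).trans (sum_inv_freqSq_le hN)
  · exact Finset.sum_le_sum_of_subset_of_nonneg (Finset.erase_subset _ _)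
      fun k _ _ => mul_nonneg (hnn k) (sq_nonneg _)
  · exact Finset.sum_nonneg fun k _ => mul_nonneg (hnn k) (sq_nonneg _)
  · have := half_le_log hN
    linarith

lemma abs_le_of_mem_trigSpace {N : ℕ} {u : Torus → ℝ} (hu : u ∈ trigSpace N) (x : Torus) :
    |u x| ≤ ((2 * π) ^ 2)⁻¹ * ‖fourierCoef u 0‖ +
      ((2 * π) ^ 2)⁻¹ * ∑ k ∈ (freqBox N).erase 0, ‖fourierCoef u k‖ := by
  have h := abs_fourierProj_le N u x
  rwa [fourierProj_eq_self hu, ← Finset.add_sum_erase _ _ (zero_mem_freqBox N), mul_add] at h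

lemma le_two_pi_sq : 36 ≤ (2 * π) ^ 2 := by
  nlinarith [Real.pi_gt_three]

lemma integrable_doubleWell {u : Torus → ℝ} (hu : Continuous u) :
    Integrable fun x => doubleWell (u x) := by
  refine integrable_of_continuous ?_
  unfold doubleWell
  fun_prop

lemma integral_doubleWell_nonneg (u : Torus → ℝ) : 0 ≤ ∫ x, doubleWell (u x) :=
  integral_nonneg fun _ => doubleWell_nonneg _

lemma sum_freqSq_nonneg (N : ℕ) (u : Torus → ℝ) :
    0 ≤ ∑ k ∈ freqBox N, freqSq k * ‖fourierCoef u k‖ ^ 2 :=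
  Finset.sum_nonneg fun k _ => mul_nonneg (freqSq_nonneg k) (sq_nonneg _)

lemma integral_doubleWell_le_energy {ν : ℝ} (hν : 0 < ν) {N : ℕ} {u : Torus → ℝ}
    (hu : u ∈ trigSpace N) : ∫ x, doubleWell (u x) ≤ energy ν u := by
  rw [energy_of_mem_trigSpace ν hu, le_add_iff_nonneg_left]
  have := sum_freqSq_nonneg N u
  positivity

/-- The mean is not seen by the gradient; the potential controls it through |r| ≤ 2 + F(r). -/
lemma norm_fourierCoef_zero_le {ν : ℝ} (hν : 0 < ν) {N : ℕ} {u : Torus → ℝ}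
    (hu : u ∈ trigSpace N) : ((2 * π) ^ 2)⁻¹ * ‖fourierCoef u 0‖ ≤ 2 + energy ν u := by
  have hc := continuous_of_mem_trigSpace hu
  have h1 : ‖fourierCoef u 0‖ ≤ ∫ x, |u x| := by
    refine (norm_integral_le_integral_norm _).trans (le_of_eq ?_)
    congr 1; ext x
    rw [norm_mul, norm_character, mul_one, Complex.norm_real, Real.norm_eq_abs]
  have hi1 : Integrable fun _ : Torus => (1 : ℝ) := integrable_const _
  have hF := integrable_doubleWell hc
  have h2 : ∫ x, |u x| ≤ 2 * (2 * π) ^ 2 + ∫ x, doubleWell (u x) := by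
    rw [← integral_one_torus, ← integral_const_mul, ← integral_add (hi1.const_mul _) hF]
    refine integral_mono (integrable_of_continuous hc.abs) ((hi1.const_mul _).add hF) fun x => ?_
    simp only [doubleWell]
    nlinarith [sq_abs (u x), sq_nonneg (|u x| - 1), sq_nonneg (u x ^ 2 - 2)]
  have h3 := integral_doubleWell_le_energy hν hu
  have h4 := integral_doubleWell_nonneg u
  have h5 := le_two_pi_sq
  rw [inv_mul_le_iff₀ (by positivity)]
  nlinarith

/-- This is the borderline embedding of H¹ into L^∞, with logarithmic loss on X_N. The energy bounds
the squared gradient norm by 2E/ν, and (2π)⁻² ≤ 1/36 absorbs the 24. -/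
lemma sum_norm_fourierCoef_le {ν : ℝ} (hν : 0 < ν) {N : ℕ} (hN : 2 ≤ N) {u : Torus → ℝ}
    (hu : u ∈ trigSpace N) :
    ((2 * π) ^ 2)⁻¹ * ∑ k ∈ (freqBox N).erase 0, ‖fourierCoef u k‖
      ≤ √(2 * energy ν u * (Real.log N / ν)) := by
  apply Real.le_sqrt_of_sq_le
  have h1 := sq_sum_erase_le hN fun k => ‖fourierCoef u k‖
  have h2 : ((2 * π) ^ 2)⁻¹ * ∑ k ∈ freqBox N, freqSq k * ‖fourierCoef u k‖ ^ 2
      ≤ 2 * energy ν u / ν := by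
    rw [energy_of_mem_trigSpace ν hu, le_div_iff₀ hν]
    linarith [integral_doubleWell_nonneg u]
  have h0 : 0 ≤ ((2 * π) ^ 2)⁻¹ * ∑ k ∈ freqBox N, freqSq k * ‖fourierCoef u k‖ ^ 2 :=
    mul_nonneg (by positivity) (sum_freqSq_nonneg N u)
  have h3 := half_le_log hN
  have h4 : ((2 * π) ^ 2)⁻¹ ≤ 36⁻¹ := inv_anti₀ (by norm_num) le_two_pi_sq
  have h5 : 0 ≤ ((2 * π) ^ 2)⁻¹ := by positivity
  set G := ∑ k ∈ freqBox N, freqSq k * ‖fourierCoef u k‖ ^ 2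
  set p := ((2 * π) ^ 2)⁻¹
  rw [mul_pow]
  calc p ^ 2 * (∑ k ∈ (freqBox N).erase 0, ‖fourierCoef u k‖) ^ 2
      ≤ p ^ 2 * (24 * Real.log N * G) := mul_le_mul_of_nonneg_left h1 (sq_nonneg _)
    _ = 24 * Real.log N * (p * (p * G)) := by ring
    _ ≤ 24 * Real.log N * (36⁻¹ * (p * G)) := by gcongr
    _ ≤ Real.log N * (p * G) := by nlinarith [mul_nonneg (by linarith : 0 ≤ Real.log N) h0]
    _ ≤ Real.log N * (2 * energy ν u / ν) := mul_le_mul_of_nonneg_left h2 (by linarith)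
    _ = 2 * energy ν u * (Real.log N / ν) := by ring

/-! ### One step of the scheme -/

/-- The Fourier form of a step `u ↦ w` of the scheme. -/
def IsStep (ν S τ : ℝ) (N : ℕ) (u w : Torus → ℝ) : Prop :=
  fourierCoef w 0 = fourierCoef u 0 ∧ ∀ k ∈ freqBox N,
    ((ν * freqSq k * (1 + S * τ * freqSq k ^ 2) : ℝ) : ℂ) * (fourierCoef w k - fourierCoef u k)
      = -((1 - Real.exp (-(ν * freqSq k ^ 2 * τ)) : ℝ) : ℂ) * (((ν * freqSq k : ℝ) : ℂ) *
        fourierCoef u k + fourierCoef (fun x => doubleWellDeriv (u x)) k)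

lemma continuous_doubleWellDeriv {u : Torus → ℝ} (hu : Continuous u) :
    Continuous fun x => doubleWellDeriv (u x) := by
  unfold doubleWellDeriv
  fun_prop

lemma one_sub_exp_bounds {x : ℝ} (hx : 0 < x) :
    0 < 1 - Real.exp (-x) ∧ 1 - Real.exp (-x) ≤ x ∧ 1 - Real.exp (-x) ≤ 1 := by
  refine ⟨?_, ?_, ?_⟩
  · have : Real.exp (-x) < 1 := Real.exp_lt_one_iff.2 (by linarith)
    linarith
  · linarith [Real.add_one_le_exp (-x)]
  · linarith [Real.exp_pos (-x)]

/-- The bound a ≤ 1 serves the linear term. For the nonlinear term a ≤ νq²τ is used, so that τ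
cancels against Sτq² and a gain 1/(Sq) remains. -/
lemma norm_step_le {ν S τ q a : ℝ} (hν : 0 < ν) (hS : 0 < S) (hτ : 0 < τ) (hq : 1 ≤ q)
    (ha0 : 0 < a) (ha1 : a ≤ ν * q ^ 2 * τ) (ha2 : a ≤ 1) {d z f : ℂ}
    (h : ((ν * q * (1 + S * τ * q ^ 2) : ℝ) : ℂ) * d = -(a : ℂ) * (((ν * q : ℝ) : ℂ) * z + f)) :
    ‖d‖ ≤ ‖z‖ + S⁻¹ * (‖f‖ * q⁻¹) := by
  have hm : 0 < ν * q * (1 + S * τ * q ^ 2) := by positivity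
  have h1 : ν * q * (1 + S * τ * q ^ 2) * ‖d‖ ≤ a * (ν * q * ‖z‖ + ‖f‖) := by
    have h2 := congrArg norm h
    rw [norm_mul, norm_mul, norm_neg, Complex.norm_real, Complex.norm_real,
      Real.norm_of_nonneg hm.le, Real.norm_of_nonneg ha0.le] at h2
    rw [h2]
    refine mul_le_mul_of_nonneg_left ((norm_add_le _ _).trans (le_of_eq ?_)) ha0.le
    rw [norm_mul, Complex.norm_real, Real.norm_of_nonneg (by positivity)]
  have h3 : a * (ν * q * ‖z‖) ≤ ν * q * (1 + S * τ * q ^ 2) * ‖z‖ := by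
    have : a ≤ 1 + S * τ * q ^ 2 := by
      have : 0 < S * τ * q ^ 2 := by positivity
      linarith
    calc a * (ν * q * ‖z‖) ≤ (1 + S * τ * q ^ 2) * (ν * q * ‖z‖) := by gcongr
      _ = _ := by ring
  have h4 : a * ‖f‖ ≤ ν * q * (1 + S * τ * q ^ 2) * (S⁻¹ * (‖f‖ * q⁻¹)) := by
    calc a * ‖f‖ ≤ ν * q ^ 2 * τ * ‖f‖ := by gcongr
      _ = ν * q * (S * τ * q ^ 2) * (S⁻¹ * (‖f‖ * q⁻¹)) := by field_simp
      _ ≤ ν * q * (1 + S * τ * q ^ 2) * (S⁻¹ * (‖f‖ * q⁻¹)) := by gcongr; linarith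
  refine le_of_mul_le_mul_left ?_ hm
  linarith

lemma energy_mode_le {ν S τ q a K : ℝ} (hν : 0 < ν) (hS : 0 < S) (hq : 1 ≤ q)
    (ha0 : 0 < a) (ha1 : a ≤ ν * q ^ 2 * τ) (ha2 : a ≤ 1) (hK : K ≤ S) {w z f : ℂ}
    (h : ((ν * q * (1 + S * τ * q ^ 2) : ℝ) : ℂ) * (w - z)
      = -(a : ℂ) * (((ν * q : ℝ) : ℂ) * z + f)) :
    ν / 2 * (q * ‖w‖ ^ 2 - q * ‖z‖ ^ 2) + ((w - z) * conj f).re + K * ‖w - z‖ ^ 2 ≤ 0 := by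
  obtain ⟨d, rfl⟩ : ∃ d, w = z + d := ⟨w - z, by ring⟩
  rw [add_sub_cancel_left] at h ⊢
  set m := ν * q * (1 + S * τ * q ^ 2) with hm
  -- The ν part uses a ≤ 1 and the S part a ≤ νq²τ; this makes the dissipation independent of τ.
  have hmd : (ν + S) * q * a ≤ m := by
    have e1 : ν * q * a ≤ ν * q := mul_le_of_le_one_right (by positivity) ha2
    have e2 : S * q * a ≤ S * q * (ν * q ^ 2 * τ) := by gcongr
    rw [hm]
    linarith
  have hkey : a * (d * conj (((ν * q : ℝ) : ℂ) * z + f)).re = -m * ‖d‖ ^ 2 := by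
    have h1 : (a : ℂ) * (d * conj (((ν * q : ℝ) : ℂ) * z + f)) = ((-m * ‖d‖ ^ 2 : ℝ) : ℂ) := by
      have h2 := congrArg conj h
      rw [map_mul, map_mul, map_neg, Complex.conj_ofReal, Complex.conj_ofReal] at h2
      calc (a : ℂ) * (d * conj (((ν * q : ℝ) : ℂ) * z + f))
          = -d * (-(a : ℂ) * conj (((ν * q : ℝ) : ℂ) * z + f)) := by ring
        _ = -m * (d * conj d) := by rw [← h2]; ring
        _ = _ := by rw [Complex.mul_conj, Complex.normSq_eq_norm_sq]; push_cast; ring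
    have h3 := congrArg Complex.re h1
    rwa [Complex.re_ofReal_mul, Complex.ofReal_re] at h3
  have hre : (d * conj (((ν * q : ℝ) : ℂ) * z + f)).re ≤ -((ν + S) * q) * ‖d‖ ^ 2 := by
    refine le_of_mul_le_mul_left ?_ ha0
    rw [hkey]
    nlinarith [mul_le_mul_of_nonneg_right hmd (sq_nonneg ‖d‖)]
  have hexp : (d * conj (((ν * q : ℝ) : ℂ) * z + f)).re
      = ν * q * (d * conj z).re + (d * conj f).re := by
    rw [map_add, map_mul, Complex.conj_ofReal, mul_add, Complex.add_re, mul_left_comm,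
      Complex.re_ofReal_mul]
  have hnorm : ‖z + d‖ ^ 2 = ‖z‖ ^ 2 + 2 * (d * conj z).re + ‖d‖ ^ 2 := by
    simp only [← Complex.normSq_eq_norm_sq, Complex.normSq_apply, Complex.add_re, Complex.add_im,
      Complex.mul_re, Complex.conj_re, Complex.conj_im]
    ring
  rw [hnorm]
  have h5 : K * ‖d‖ ^ 2 ≤ S * q * ‖d‖ ^ 2 := by
    refine mul_le_mul_of_nonneg_right ?_ (sq_nonneg _)
    nlinarith
  have h6 : 0 ≤ ν * q * ‖d‖ ^ 2 := by positivity
  linarith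

/-- The a priori bound on the next iterate. -/
lemma IsStep.sup_bound {ν S τ B : ℝ} {N : ℕ} {u w : Torus → ℝ} (h : IsStep ν S τ N u w)
    (hν : 0 < ν) (hS : 0 < S) (hτ : 0 < τ) (hN : 2 ≤ N) (hu : u ∈ trigSpace N)
    (hw : w ∈ trigSpace N)
    (hB : 2 + energy ν u + √(2 * energy ν u * (Real.log N / ν)) ≤ B)
    (hSE : 4 * Real.log N * energy ν u ≤ S ^ 2) (x : Torus) :
    |u x| ≤ B ∧ |w x| ≤ 3 * B := by
  have hc := continuous_of_mem_trigSpace hu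
  have h0 := norm_fourierCoef_zero_le hν hu
  have h1 := sum_norm_fourierCoef_le hν hN hu
  have huB : ∀ y, |u y| ≤ B := fun y => by
    have := abs_le_of_mem_trigSpace hu y
    linarith
  have hB0 : 0 ≤ B := (abs_nonneg _).trans (huB x)
  refine ⟨huB x, ?_⟩
  set f : Torus → ℝ := fun x => doubleWellDeriv (u x) with hf
  have hfc : Continuous f := continuous_doubleWellDeriv hc
  have hE0 := integral_doubleWell_nonneg u
  have hE := integral_doubleWell_le_energy hν hu
  -- The identity f² = 4u²F(u) bounds f in L² by the energy with only two powers of B.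
  have hf2 : ∫ x, f x ^ 2 ≤ 4 * B ^ 2 * energy ν u := by
    have e1 : ∫ x, f x ^ 2 ≤ ∫ x, 4 * B ^ 2 * doubleWell (u x) := by
      refine integral_mono (integrable_of_continuous (hfc.pow 2))
        ((integrable_doubleWell hc).const_mul _) fun y => ?_
      have e2 : f y ^ 2 = 4 * u y ^ 2 * doubleWell (u y) := by
        simp only [hf, doubleWellDeriv, doubleWell]; ring
      have e3 : u y ^ 2 ≤ B ^ 2 := sq_le_sq' (abs_le.1 (huB y)).1 (abs_le.1 (huB y)).2
      change f y ^ 2 ≤ _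
      rw [e2]
      exact mul_le_mul_of_nonneg_right (by linarith) (doubleWell_nonneg _)
    rw [integral_const_mul] at e1
    exact e1.trans (mul_le_mul_of_nonneg_left hE (by positivity))
  have hℓ := half_le_log hN
  set ℓ := Real.log N
  have h4 : ((2 * π) ^ 2)⁻¹ ≤ 36⁻¹ := inv_anti₀ (by norm_num) le_two_pi_sq
  have h5 : 0 < ((2 * π) ^ 2)⁻¹ := by positivity
  -- Cauchy–Schwarz against |k|⁻² costs log N, which `hSE` pays for: 4 log N · E ≤ S². The remaining
  -- factor is 24/36 ≤ 1.
  have hY : ((2 * π) ^ 2)⁻¹ * ∑ k ∈ (freqBox N).erase 0, ‖fourierCoef f k‖ * (freqSq k)⁻¹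
      ≤ B * S := by
    refine le_of_sq_le_sq ?_ (by positivity)
    have e1 := sq_sum_erase_le hN fun k => ‖fourierCoef f k‖ * (freqSq k)⁻¹
    have e2 : ∑ k ∈ freqBox N, freqSq k * (‖fourierCoef f k‖ * (freqSq k)⁻¹) ^ 2
        ≤ ∑ k ∈ freqBox N, ‖fourierCoef f k‖ ^ 2 := by
      refine Finset.sum_le_sum fun k _ => ?_
      by_cases hk : k = 0
      · subst hk
        simp [freqSq_zero]
      · have hq := one_le_freqSq hk
        have : freqSq k * (‖fourierCoef f k‖ * (freqSq k)⁻¹) ^ 2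
            = ‖fourierCoef f k‖ ^ 2 * (freqSq k)⁻¹ := by field_simp
        rw [this]
        exact mul_le_of_le_one_right (sq_nonneg _) (inv_le_one_of_one_le₀ hq)
    have e3 := sum_sq_fourierCoef_le (memLp_of_continuous hfc 2) N
    set p := ((2 * π) ^ 2)⁻¹ with hp
    have hpp : p * (2 * π) ^ 2 = 1 := inv_mul_cancel₀ two_pi_sq_ne_zero
    rw [mul_pow]
    calc p ^ 2 * (∑ k ∈ (freqBox N).erase 0, ‖fourierCoef f k‖ * (freqSq k)⁻¹) ^ 2
        ≤ p ^ 2 * (24 * ℓ * ((2 * π) ^ 2 * (4 * B ^ 2 * energy ν u))) := by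
          refine mul_le_mul_of_nonneg_left (e1.trans ?_) (sq_nonneg _)
          refine mul_le_mul_of_nonneg_left ((e2.trans e3).trans ?_) (by linarith)
          exact mul_le_mul_of_nonneg_left hf2 (by positivity)
      _ = p * (p * (2 * π) ^ 2) * (24 * B ^ 2 * (4 * ℓ * energy ν u)) := by ring
      _ = p * (24 * B ^ 2 * (4 * ℓ * energy ν u)) := by rw [hpp, mul_one]
      _ ≤ p * (24 * B ^ 2 * S ^ 2) := by gcongr
      _ ≤ 36⁻¹ * (24 * B ^ 2 * S ^ 2) := by gcongr
      _ ≤ (B * S) ^ 2 := by nlinarith [sq_nonneg (B * S)]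
  have hsum : ∑ k ∈ (freqBox N).erase 0, ‖fourierCoef w k‖
      ≤ 2 * (∑ k ∈ (freqBox N).erase 0, ‖fourierCoef u k‖)
        + S⁻¹ * ∑ k ∈ (freqBox N).erase 0, ‖fourierCoef f k‖ * (freqSq k)⁻¹ := by
    rw [Finset.mul_sum, Finset.mul_sum, ← Finset.sum_add_distrib]
    refine Finset.sum_le_sum fun k hk => ?_
    have hq := one_le_freqSq (Finset.ne_of_mem_erase hk)
    obtain ⟨a0, a1, a2⟩ := one_sub_exp_bounds (x := ν * freqSq k ^ 2 * τ) (by positivity)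
    have hd := norm_step_le hν hS hτ hq a0 a1 a2 (h.2 k (Finset.mem_of_mem_erase hk))
    have htri := norm_add_le (fourierCoef u k) (fourierCoef w k - fourierCoef u k)
    rw [add_sub_cancel] at htri
    linarith
  have hwx := abs_le_of_mem_trigSpace hw x
  rw [h.1] at hwx
  have hsum' := mul_le_mul_of_nonneg_left hsum h5.le
  have hY' : S⁻¹ * (((2 * π) ^ 2)⁻¹ *
      ∑ k ∈ (freqBox N).erase 0, ‖fourierCoef f k‖ * (freqSq k)⁻¹) ≤ B := by
    rw [inv_mul_le_iff₀ hS, mul_comm S]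
    exact hY
  have hn : 0 ≤ ((2 * π) ^ 2)⁻¹ * ‖fourierCoef u 0‖ := by positivity
  rw [mul_add, mul_left_comm _ S⁻¹, mul_left_comm _ (2 : ℝ)] at hsum'
  linarith

/-- The Taylor remainder is exactly (((r + s)/2)² + r²/2 - 1/2)(s - r)², and its coefficient is at
most 4B² + B²/2. -/
lemma doubleWell_sub_le {B r s : ℝ} (hr : |r| ≤ B) (hs : |s| ≤ 3 * B) :
    doubleWell s - doubleWell r ≤ doubleWellDeriv r * (s - r) + 5 * B ^ 2 * (s - r) ^ 2 := by
  have e : doubleWell s - doubleWell r - doubleWellDeriv r * (s - r)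
      = (((r + s) / 2) ^ 2 + r ^ 2 / 2 - 1 / 2) * (s - r) ^ 2 := by
    simp only [doubleWell, doubleWellDeriv]; ring
  have h1 : ((r + s) / 2) ^ 2 ≤ (2 * B) ^ 2 := by
    rw [abs_le] at hr hs
    exact sq_le_sq' (by linarith) (by linarith)
  have h2 : r ^ 2 ≤ B ^ 2 := sq_le_sq' (abs_le.1 hr).1 (abs_le.1 hr).2
  have h3 : (((r + s) / 2) ^ 2 + r ^ 2 / 2 - 1 / 2) * (s - r) ^ 2
      ≤ 5 * B ^ 2 * (s - r) ^ 2 :=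
    mul_le_mul_of_nonneg_right (by nlinarith [sq_nonneg B]) (sq_nonneg _)
  linarith

/-- The energy decreases in a step if `S` dominates the square of the sup norm. -/
lemma IsStep.energy_le {ν S τ B : ℝ} {N : ℕ} {u w : Torus → ℝ} (h : IsStep ν S τ N u w)
    (hν : 0 < ν) (hS : 0 < S) (hτ : 0 < τ) (hu : u ∈ trigSpace N) (hw : w ∈ trigSpace N)
    (huB : ∀ x, |u x| ≤ B) (hwB : ∀ x, |w x| ≤ 3 * B) (hSB : 5 * B ^ 2 ≤ S) :
    energy ν w ≤ energy ν u := by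
  have huc := continuous_of_mem_trigSpace hu
  have hwc := continuous_of_mem_trigSpace hw
  set f : Torus → ℝ := fun x => doubleWellDeriv (u x) with hf
  have hfc : Continuous f := continuous_doubleWellDeriv huc
  have hd : w - u ∈ trigSpace N := Submodule.sub_mem _ hw hu
  have hdc := continuous_of_mem_trigSpace hd
  have hdcoef : ∀ k, fourierCoef (w - u) k = fourierCoef w k - fourierCoef u k :=
    fourierCoef_sub (integrable_of_continuous hwc) (integrable_of_continuous huc)
  have hpot : (∫ x, doubleWell (w x)) - ∫ x, doubleWell (u x) ≤
      (∫ x, f x * (w - u) x) + 5 * B ^ 2 * ∫ x, (w - u) x ^ 2 := by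
    have i1 : Integrable fun x => f x * (w - u) x := integrable_of_continuous (hfc.mul hdc)
    have i2 : Integrable fun x => (w - u) x ^ 2 := integrable_of_continuous (hdc.pow 2)
    rw [← integral_const_mul, ← integral_add i1 (i2.const_mul _),
      ← integral_sub (integrable_doubleWell hwc) (integrable_doubleWell huc)]
    exact integral_mono ((integrable_doubleWell hwc).sub (integrable_doubleWell huc))
      (i1.add (i2.const_mul _)) fun x => doubleWell_sub_le (huB x) (hwB x)
  rw [integral_mul_of_mem_trigSpace hd (integrable_of_continuous hfc),
    integral_sq_of_mem_trigSpace hd] at hpot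
  simp only [hdcoef] at hpot
  have hmodes : ∑ k ∈ freqBox N,
      (ν / 2 * (freqSq k * ‖fourierCoef w k‖ ^ 2 - freqSq k * ‖fourierCoef u k‖ ^ 2)
      + ((fourierCoef w k - fourierCoef u k) * conj (fourierCoef f k)).re
      + 5 * B ^ 2 * ‖fourierCoef w k - fourierCoef u k‖ ^ 2) ≤ 0 := by
    refine Finset.sum_nonpos fun k hk => ?_
    -- The zero mode has no dissipation, but conservation of the mean makes its contribution vanish.
    by_cases hk0 : k = 0
    · subst hk0
      simp [h.1, freqSq_zero]
    · have hq := one_le_freqSq hk0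
      obtain ⟨a0, a1, a2⟩ := one_sub_exp_bounds (x := ν * freqSq k ^ 2 * τ) (by positivity)
      exact energy_mode_le hν hS hq a0 a1 a2 hSB (h.2 k hk)
  rw [Finset.sum_add_distrib, Finset.sum_add_distrib, ← Finset.mul_sum, ← Finset.mul_sum,
    Finset.sum_sub_distrib] at hmodes
  have hp : 0 < ((2 * π) ^ 2)⁻¹ := by positivity
  have hm := mul_le_mul_of_nonneg_left hmodes hp.le
  rw [energy_of_mem_trigSpace ν hu, energy_of_mem_trigSpace ν hw]
  linarith

/-! ### The Fourier form of the scheme -/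

/-- Multiplication by ν|k|² clears the denominator of `phiSymbol` but erases the equation at k = 0,
which is why `IsStep` records conservation of the mean separately. -/
lemma isStep_of_fourierCoef {ν S τ : ℝ} {N : ℕ} {u w : Torus → ℝ} (hν : 0 < ν)
    (h : ∀ k ∈ freqBox N, ((1 + S * τ * freqSq k ^ 2 : ℝ) : ℂ) * (fourierCoef w k - fourierCoef u k)
      = ((expSymbol ν τ (-freqSq k) - 1 : ℝ) : ℂ) * fourierCoef u k +
        (phiSymbol ν τ (-freqSq k) : ℂ) * fourierCoef (fun x => doubleWellDeriv (u x)) k) :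
    IsStep ν S τ N u w := by
  constructor
  · have h0 := h 0 (zero_mem_freqBox N)
    rw [← sub_eq_zero]
    -- Division by zero returns 0, which is the prescribed limit of the symbol at k = 0.
    simpa [freqSq_zero, expSymbol, phiSymbol] using h0
  · intro k hk
    by_cases hk0 : k = 0
    · subst hk0
      simp [freqSq_zero]
    have hq := one_le_freqSq hk0
    set q := freqSq k
    have hphi : ν * q * phiSymbol ν τ (-q) = -(1 - Real.exp (-(ν * q ^ 2 * τ))) := by
      have he : -ν * (-q) ^ 2 * τ = -(ν * q ^ 2 * τ) := by ring
      rw [phiSymbol, he]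
      field_simp
    have hexp : expSymbol ν τ (-q) - 1 = -(1 - Real.exp (-(ν * q ^ 2 * τ))) := by
      have he : -ν * (-q) ^ 2 * τ = -(ν * q ^ 2 * τ) := by ring
      rw [expSymbol, he]
      ring
    have h1 := h k hk
    calc ((ν * q * (1 + S * τ * q ^ 2) : ℝ) : ℂ) * (fourierCoef w k - fourierCoef u k)
        = ((ν * q : ℝ) : ℂ) *
          (((1 + S * τ * q ^ 2 : ℝ) : ℂ) * (fourierCoef w k - fourierCoef u k)) := by
          rw [Complex.ofReal_mul (ν * q)]; ring
      _ = ((ν * q : ℝ) : ℂ) * ((expSymbol ν τ (-q) - 1 : ℝ) : ℂ) * fourierCoef u k +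
          ((ν * q * phiSymbol ν τ (-q) : ℝ) : ℂ) *
            fourierCoef (fun x => doubleWellDeriv (u x)) k := by
          rw [h1, Complex.ofReal_mul (ν * q)]; ring
      _ = _ := by
          rw [hphi, hexp, Complex.ofReal_neg]; ring

lemma integrable_laplaceFun (N : ℕ) (g : ℝ → ℝ) (u : Torus → ℝ) :
    Integrable (laplaceFun N g u) :=
  integrable_of_continuous (continuous_laplaceFun _ _ _)

lemma integrable_of_mem_trigSpace {N : ℕ} {u : Torus → ℝ} (hu : u ∈ trigSpace N) :
    Integrable u :=
  integrable_of_continuous (continuous_of_mem_trigSpace hu)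

lemma IsEIScheme.isStep {ν S τ : ℝ} {N : ℕ} {u₀ : Torus → ℝ} {u : ℕ → Torus → ℝ}
    (h : IsEIScheme ν S τ N u₀ u) (hν : 0 < ν) (n : ℕ) : IsStep ν S τ N (u n) (u (n + 1)) := by
  obtain ⟨hmem, -, hstep⟩ := h
  refine isStep_of_fourierCoef hν fun k hk => ?_
  have h1 := congrArg (fun v => fourierCoef v k) (hstep n)
  rw [fourierCoef_sub ((integrable_laplaceFun _ _ _).add (integrable_laplaceFun _ _ _))
      ((integrable_laplaceFun _ _ _).smul _),
    fourierCoef_add (integrable_laplaceFun _ _ _) (integrable_laplaceFun _ _ _),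
    fourierCoef_smul, fourierCoef_laplaceFun, fourierCoef_laplaceFun, fourierCoef_laplaceFun,
    fourierCoef_fourierProj, if_pos hk, if_pos hk, if_pos hk, if_pos hk,
    fourierCoef_sub (integrable_of_mem_trigSpace (hmem _)) (integrable_of_mem_trigSpace (hmem _))]
    at h1
  push_cast at h1 ⊢
  linear_combination h1

lemma IsEISchemeQuot.isStep {ν S τ : ℝ} {N : ℕ} {u₀ : Torus → ℝ} {u : ℕ → Torus → ℝ}
    (h : IsEISchemeQuot ν S τ N u₀ u) (hν : 0 < ν) (hτ : 0 < τ) (n : ℕ) :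
    IsStep ν S τ N (u n) (u (n + 1)) := by
  obtain ⟨hmem, -, hstep⟩ := h
  refine isStep_of_fourierCoef hν fun k hk => ?_
  have h1 := congrArg (fun v => fourierCoef v k) (hstep n)
  have hi := fun n => integrable_of_mem_trigSpace (hmem n)
  rw [fourierCoef_add (((hi _).sub (hi _)).smul _) ((integrable_laplaceFun _ _ _).smul _),
    fourierCoef_add (integrable_laplaceFun _ _ _) (integrable_laplaceFun _ _ _),
    fourierCoef_smul, fourierCoef_smul, fourierCoef_laplaceFun, fourierCoef_laplaceFun,
    fourierCoef_laplaceFun, fourierCoef_fourierProj, if_pos hk, if_pos hk, if_pos hk, if_pos hk,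
    fourierCoef_sub (hi _) (hi _)] at h1
  have hτ' : (τ : ℂ) ≠ 0 := by exact_mod_cast hτ.ne'
  push_cast at h1 ⊢
  field_simp at h1
  linear_combination h1

/-- By the arithmetic–geometric mean inequality (ℓ/ν + ν)² ≥ 4ℓ ≥ 2. This keeps S away from 0 for
every ν and supplies the log N needed in the sup bound. -/
lemma one_le_log_div_add {ν ℓ : ℝ} (hν : 0 < ν) (hℓ : 1 / 2 ≤ ℓ) :
    1 ≤ ℓ / ν + ν ∧ 4 * ℓ ≤ (ℓ / ν + ν) ^ 2 := by
  have h0 : 0 ≤ ℓ / ν := div_nonneg (by linarith) hν.le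
  have h1 : ℓ / ν * ν = ℓ := div_mul_cancel₀ _ hν.ne'
  have h2 : 4 * ℓ ≤ (ℓ / ν + ν) ^ 2 := by nlinarith [sq_nonneg (ℓ / ν - ν)]
  exact ⟨by nlinarith, h2⟩

lemma IsStep.energy_le_of_stabilization {ν S τ β e : ℝ} {N : ℕ} {u w : Torus → ℝ}
    (h : IsStep ν S τ N u w) (hν : 0 < ν) (hτ : 0 < τ) (hN : 2 ≤ N) (hu : u ∈ trigSpace N)
    (hw : w ∈ trigSpace N) (he : 0 ≤ e) (hE : energy ν u ≤ e) (hβ : 30 * (2 + e) ^ 2 ≤ β)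
    (hS : β * (Real.log N / ν + ν) ≤ S) : energy ν w ≤ energy ν u := by
  have hℓ := half_le_log hN
  set ℓ := Real.log N with hℓdef
  obtain ⟨hm1, hm2⟩ := one_le_log_div_add hν hℓ
  have h0 : 0 ≤ ℓ / ν := div_nonneg (by linarith) hν.le
  set m := ℓ / ν + ν with hm
  have hE0 : 0 ≤ energy ν u :=
    (integral_doubleWell_nonneg u).trans (integral_doubleWell_le_energy hν hu)
  have hβ1 : 1 ≤ β := by nlinarith
  have hβm : β ≤ β * m := le_mul_of_one_le_right (by linarith) hm1
  have hS0 : 0 < S := by linarith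
  set B := 2 + e + √(2 * e * (ℓ / ν)) with hB
  have hB' : 2 + energy ν u + √(2 * energy ν u * (ℓ / ν)) ≤ B := by
    have : √(2 * energy ν u * (ℓ / ν)) ≤ √(2 * e * (ℓ / ν)) :=
      Real.sqrt_le_sqrt (by gcongr)
    linarith
  have hsq : √(2 * e * (ℓ / ν)) ^ 2 = 2 * e * (ℓ / ν) := Real.sq_sqrt (by positivity)
  -- Here 5B² ≤ 10(2 + e)² + 20e·ℓ/ν ≤ 30(2 + e)²·m, which is the origin of the 30.
  have hB2 : 5 * B ^ 2 ≤ S := by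
    have e1 : B ^ 2 ≤ 2 * (2 + e) ^ 2 + 4 * e * (ℓ / ν) := by
      rw [hB]
      nlinarith [sq_nonneg (2 + e - √(2 * e * (ℓ / ν)))]
    have e2 : (2 + e) ^ 2 ≤ (2 + e) ^ 2 * m := le_mul_of_one_le_right (sq_nonneg _) hm1
    have e3 : e * (ℓ / ν) ≤ (2 + e) ^ 2 * m :=
      mul_le_mul (by nlinarith) (by linarith) h0 (sq_nonneg _)
    have e4 : 30 * (2 + e) ^ 2 * m ≤ β * m := mul_le_mul_of_nonneg_right hβ (by linarith)
    linarith
  have hSE : 4 * ℓ * energy ν u ≤ S ^ 2 := by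
    calc 4 * ℓ * energy ν u ≤ m ^ 2 * β ^ 2 := by
          refine mul_le_mul hm2 ?_ hE0 (sq_nonneg _)
          nlinarith
      _ = (β * m) ^ 2 := by ring
      _ ≤ S ^ 2 := pow_le_pow_left₀ (by positivity) hS 2
  have hb := h.sup_bound hν hS0 hτ hN hu hw hB' hSE
  exact h.energy_le hν hS0 hτ hu hw (fun x => (hb x).1) (fun x => (hb x).2) hB2

end CahnHilliard

end

/-! ### The choice of the constant and the induction on time steps -/

theorem theorem1p4 :
    ∃ β₀ : ℝ → ℝ, (∀ e : ℝ, 0 < β₀ e) ∧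
      ∀ (ν : ℝ) (u₀ : CahnHilliard.Torus → ℝ) (N : ℕ) (β S τ : ℝ)
        (u : ℕ → CahnHilliard.Torus → ℝ),
        0 < ν → CahnHilliard.MemSobolev 2 u₀ → 2 ≤ N → 0 < τ →
        β₀ (CahnHilliard.energy ν u₀) ≤ β →
        β * (CahnHilliard.sobolevNorm 2 u₀ ^ 2 + ν⁻¹ * |Real.log ν| + ν⁻¹ * Real.log N + ν) ≤ S →
        (CahnHilliard.IsEIScheme ν S τ N u₀ u ∨ CahnHilliard.IsEISchemeQuot ν S τ N u₀ u) →
        ∀ n : ℕ, CahnHilliard.energy ν (u (n + 1)) ≤ CahnHilliard.energy ν (u n) := by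
  -- The inner expression is the bound for E(Π_N u₀) in terms of E(u₀). The absolute value keeps β₀
  -- positive on all of ℝ and disappears because energies are nonnegative.
  refine ⟨fun e => 30 * (2 + 50 ^ 4 * (2 * |e| + 21)) ^ 2, fun e => by positivity, ?_⟩
  intro ν u₀ N β S τ u hν hu₀ hN hτ hβ hS hscheme
  obtain ⟨hE0, hEproj⟩ := CahnHilliard.energy_fourierProj_le hν hu₀ N
  beta_reduce at hβ
  rw [abs_of_nonneg hE0] at hβ
  set e := 50 ^ 4 * (2 * CahnHilliard.energy ν u₀ + 21) with he
  have he0 : 0 ≤ e := by positivity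
  have hβ0 : 0 ≤ β := le_trans (by positivity) hβ
  have hS' : β * (Real.log N / ν + ν) ≤ S := by
    refine le_trans (mul_le_mul_of_nonneg_left ?_ hβ0) hS
    have h1 : 0 ≤ CahnHilliard.sobolevNorm 2 u₀ ^ 2 := sq_nonneg _
    have h2 : 0 ≤ ν⁻¹ * |Real.log ν| := by positivity
    rw [div_eq_inv_mul]
    linarith
  have hmem : ∀ n, u n ∈ CahnHilliard.trigSpace N := hscheme.elim (fun h => h.1) fun h => h.1
  have hstart : u 0 = CahnHilliard.fourierProj N u₀ :=
    hscheme.elim (fun h => h.2.1) fun h => h.2.1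
  have hstep : ∀ n, CahnHilliard.IsStep ν S τ N (u n) (u (n + 1)) := fun n =>
    hscheme.elim (fun h => h.isStep hν n) fun h => h.isStep hν hτ n
  have hdecay : ∀ n, CahnHilliard.energy ν (u n) ≤ e →
      CahnHilliard.energy ν (u (n + 1)) ≤ CahnHilliard.energy ν (u n) := fun n hn =>
    (hstep n).energy_le_of_stabilization hν hτ hN (hmem n) (hmem (n + 1)) he0 hn hβ hS'
  -- Decay needs only the fixed bound e and reproduces it, so one S serves all steps.
  have hbound : ∀ n, CahnHilliard.energy ν (u n) ≤ e := by
    intro n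
    induction n with
    | zero => rw [hstart]; exact hEproj
    | succ n ih => exact (hdecay n ih).trans ih
  exact fun n => hdecay n (hbound n)
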